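/- **Setting.** Let $\Omega\subset\mathbb R^n$ be bounded and open, $\epsilon\in(0,\infty]$, $T>0$, $0<a_*\le a^*$. Put $\Omega_{\mathcal I}=\{y\notin\Omega:\ |y-x|\le\epsilon\text{ for some }x\in\Omega\}$, $\tilde\Omega=\Omega\cup\Omega_{\mathcal I}$, $Q=\Omega\times(0,T)$, $\tilde Q=\tilde\Omega\times(0,T)$. Let $\beta$ be continuous on $\tilde\Omega$ with $0<\beta_*\le\beta(x)\le\beta^*<1$ for some constants $\beta_*,\beta^*$. Let $a=(a_{ij}(t,x,y))_{1\le i,j\le n}$ be symmetric with $a_{ij}\in C^1([0,T]\times\mathbb R^n\times\mathbb R^n)$ and $$a_*|\xi|^2\le\sum_{i,j}a_{ij}\xi_i\xi_j\le a^*|\xi|^2,\qquad \sum_{i,j}\partial_t a_{ij}\,\xi_i\xi_j\le a^*|\xi|^2$$ for $\xi\in\mathbb R^n$, $t\in[0,T]$ and $x,y\in\tilde\Omega$ with $|y-x|\le\epsilon$. Put $\alpha(x,y)=\frac{y-x}{|y-x|^{n/2+\beta(x)+1}}1_{\{|y-x|\le\epsilon\}}$, $\mathcal D^*v(x,y)=-(v(y)-v(x))\alpha(x,y)$,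 and $$B_t(v,w)=\int_{\tilde\Omega}\int_{\tilde\Omega}\mathcal D^*v\cdot\big(a(t,x,y)\,\mathcal D^*w\big)\,dy\,dx .$$ Let $\|v\|_{H^{\beta(\cdot)}(\tilde\Omega)}=\|v\|_{L^2(\tilde\Omega)}+\Big(\int_{\tilde\Omega}\int_{\tilde\Omega}\frac{(v(y)-v(x))^2}{|y-x|^{n+2\beta(x)}}dy\,dx\Big)^{1/2}$. A subscript $c$ denotes the constraint $v=0$ a.e. on $\Omega_{\mathcal I}$ (Dirichlet case), respectively $v\in L^1(\tilde\Omega)$ and $\int_{\tilde\Omega}v\,dx=0$ (Neumann case). Let $V_c$ be the set of $v\in L^2_c(\tilde\Omega)$ with $B_t(v,v)<\infty$ for $t\in[0,T]$. Let $u$ be a solution with zero source of the Dirichlet or of the Neumann volume-constrained problem for $\partial_tu+\mathcal D(a\cdot\mathcal D^*u)=0$, in the following sense: $u\in L^2(0,T;V_c)$, the weak derivative $\partial_tu$ lies in $L^2(0,T;L^2(\Omega))$, and for all $\phi\in V_c$ $$\int_\Omega\partial_tu\,\phi\,dx+B_t(u,\phi)=0\quad\text{for a.e. }t\in(0,T).$$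 Assume also $u\in C((0,T];H^{\beta(\cdot)}_c(\tilde\Omega))$. **Theorem.** (i) For every $t_0\in(0,T)$ there are $\theta\in(0,1)$ and $C>0$, depending only on $t_0,a_*,a^*,T,\Omega,\Omega_{\mathcal I}$, such that $$\|u(\cdot,t_0)\|_{L^2(\Omega)}\le C\,\|u\|_{L^2(\tilde Q)}^{1-\theta}\,\|u(\cdot,T)\|_{H^{\beta(\cdot)}(\tilde\Omega)}^{\theta}.$$ (ii) If in addition $u(\cdot,0)\in L^2_c(\tilde\Omega)$ is the initial value of $u$ (attained in $L^2(\Omega)$ as $t\downarrow0$), then $$\|u\|_{L^2(Q)}=O\Big(\Big(\log\frac1{\|u(\cdot,T)\|_{H^{\beta(\cdot)}(\tilde\Omega)}}\Big)^{-1/2}\Big)\quad\text{as }\|u(\cdot,T)\|_{H^{\beta(\cdot)}(\tilde\Omega)}\to0,$$ with the following uniformity: there is $C>0$ depending only on $a_*,a^*,T,\Omega,\Omega_{\mathcal I}$ such that, whenever $0<\|u(\cdot,T)\|_{H^{\beta(\cdot)}(\tilde\Omega)}<1$, $$\|u\|_{L^2(Q)}\le C\big(1+\|u(\cdot,0)\|_{L^2(\tilde\Omega)}\big)\Big(\log\frac1{\|u(\cdot,T)\|_{H^{\beta(\cdot)}(\tilde\Omega)}}\Big)^{-1/2}.$$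 -/

import Mathlib

open MeasureTheory Set Filter Topology
open scoped ENNReal ContDiff Matrix

namespace NonlocalDiffusion

noncomputable section

/-- The space `ℝⁿ` with its Euclidean norm. -/
abbrev Rn (n : ℕ) : Type := EuclideanSpace ℝ (Fin n)

/-- The two types of volume constraint. -/
inductive Constraint where
  | dirichlet
  | neumann

variable {n : ℕ}

/-- `α(x,y) = (y - x) / |y - x|^(n/2 + β(x) + 1)` for `|y - x| ≤ ε`, and `0` otherwise.
The horizon `ε` may be `∞`. -/
def alpha (ε : ℝ≥0∞) (β : Rn n → ℝ) (x y : Rn n) : Fin n → ℝ :=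
  open Classical in
  if edist y x ≤ ε then fun i => (y i - x i) / ‖y - x‖ ^ ((n : ℝ) / 2 + β x + 1) else 0

/-- The interaction domain `Ω_I`: the points outside `Ω` at distance at most `ε` from some point
of `Ω`, that is, the points `y ∉ Ω` with `α(x,y) ≠ 0` for some `x ∈ Ω`
(see `mem_interactionDomain_iff`). -/
def interactionDomain (Ω : Set (Rn n)) (ε : ℝ≥0∞) : Set (Rn n) :=
  {y | y ∉ Ω ∧ ∃ x ∈ Ω, edist y x ≤ ε}

theorem mem_interactionDomain_iff (Ω : Set (Rn n)) (ε : ℝ≥0∞) (β : Rn n → ℝ) (y : Rn n) :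
    y ∈ interactionDomain Ω ε ↔ y ∉ Ω ∧ ∃ x ∈ Ω, alpha ε β x y ≠ 0 := by
  constructor
  · rintro ⟨hy, x, hx, hxy⟩
    refine ⟨hy, x, hx, fun h0 => hy ?_⟩
    have hyx : y = x := by
      by_contra hne
      have hpos : 0 < ‖y - x‖ := norm_pos_iff.2 (sub_ne_zero.2 hne)
      apply hne
      ext i
      have h1 := congrFun h0 i
      rw [alpha, if_pos hxy] at h1
      have h2 := (div_eq_zero_iff.1 h1).resolve_right (Real.rpow_pos_of_pos hpos _).ne'
      linarith
    exact hyx ▸ hx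
  · rintro ⟨hy, x, hx, hne⟩
    refine ⟨hy, x, hx, ?_⟩
    by_contra hlt
    exact hne (by rw [alpha, if_neg hlt])

/-- `Ω̃ = Ω ∪ Ω_I`. -/
def tildeDomain (Ω : Set (Rn n)) (ε : ℝ≥0∞) : Set (Rn n) :=
  Ω ∪ interactionDomain Ω ε

/-- `L²(Ω̃)`. -/
abbrev L2tilde (Ω : Set (Rn n)) (ε : ℝ≥0∞) : Type :=
  Lp ℝ 2 (volume.restrict (tildeDomain Ω ε))

/-- `L²(Ω)`; as `Ω ⊆ Ω̃`, the measure is Lebesgue measure on `Ω`. -/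
abbrev L2dom (Ω : Set (Rn n)) (ε : ℝ≥0∞) : Type :=
  Lp ℝ 2 ((volume.restrict (tildeDomain Ω ε)).restrict Ω)

/-- The restriction operator `L²(Ω̃) → L²(Ω)`. -/
abbrev resDom (Ω : Set (Rn n)) (ε : ℝ≥0∞) : L2tilde Ω ε →L[ℝ] L2dom Ω ε :=
  LpToLpRestrictCLM (Rn n) ℝ ℝ (volume.restrict (tildeDomain Ω ε)) 2 Ω

/-- The constraint `E_c(v) = 0`, where `E_c(v) = ∫_{Ω_I} v²` in the Dirichlet case and
`E_c(v) = (∫_{Ω̃} v)²` in the Neumann case. Integrability in the Neumann case is automatic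
when `ε < ∞`. -/
def ConstraintZero (bc : Constraint) (Ω : Set (Rn n)) (ε : ℝ≥0∞) (v : L2tilde Ω ε) : Prop :=
  match bc with
  | .dirichlet => ∫ x in interactionDomain Ω ε, (v x) ^ 2 = 0
  | .neumann => Integrable v (volume.restrict (tildeDomain Ω ε)) ∧
      (∫ x in tildeDomain Ω ε, v x) ^ 2 = 0

/-- The squared seminorm of the variable-order Sobolev space `H^{β(·)}(Ω̃)`. -/
def sobolevSemiSq (Ω : Set (Rn n)) (ε : ℝ≥0∞) (β : Rn n → ℝ) (v : L2tilde Ω ε) : ℝ≥0∞ :=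
  ∫⁻ x in tildeDomain Ω ε, ∫⁻ y in tildeDomain Ω ε,
    ENNReal.ofReal ((v y - v x) ^ 2 / ‖y - x‖ ^ ((n : ℝ) + 2 * β x))

/-- The norm `‖v‖_{L²(Ω̃)} + |v|_{H^{β(·)}(Ω̃)}`, with value `∞` outside `H^{β(·)}(Ω̃)`. -/
def sobolevENorm (Ω : Set (Rn n)) (ε : ℝ≥0∞) (β : Rn n → ℝ) (v : L2tilde Ω ε) : ℝ≥0∞ :=
  ‖v‖ₑ + (sobolevSemiSq Ω ε β v) ^ (1 / 2 : ℝ)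

/-- The norm of `H^{β(·)}(Ω̃)` as a real number. -/
def sobolevNorm (Ω : Set (Rn n)) (ε : ℝ≥0∞) (β : Rn n → ℝ) (v : L2tilde Ω ε) : ℝ :=
  (sobolevENorm Ω ε β v).toReal

/-- Membership in `H_c^{β(·)}(Ω̃)`. -/
def MemHc (bc : Constraint) (Ω : Set (Rn n)) (ε : ℝ≥0∞) (β : Rn n → ℝ) (v : L2tilde Ω ε) : Prop :=
  sobolevENorm Ω ε β v < ⊤ ∧ ConstraintZero bc Ω ε v

/-- The adjoint nonlocal divergence `D*(v)(x,y) = -(v(y) - v(x)) α(x,y)`. -/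
def Dstar (ε : ℝ≥0∞) (β : Rn n → ℝ) (v : Rn n → ℝ) (x y : Rn n) : Fin n → ℝ :=
  (-(v y - v x)) • alpha ε β x y

/-- The bilinear form `∫_{Ω̃} ∫_{Ω̃} D*(v) · (a(t,x,y) · D*(w)) dy dx`. -/
def energyForm (Ω : Set (Rn n)) (ε : ℝ≥0∞) (β : Rn n → ℝ)
    (a : ℝ → Rn n → Rn n → Matrix (Fin n) (Fin n) ℝ) (t : ℝ) (v w : L2tilde Ω ε) : ℝ :=
  ∫ x in tildeDomain Ω ε, ∫ y in tildeDomain Ω ε,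
    Dstar ε β v x y ⬝ᵥ (a t x y *ᵥ Dstar ε β w x y)

/-- The squared nonlocal energy norm `|||v|||²` at time `t`. -/
def energySq (Ω : Set (Rn n)) (ε : ℝ≥0∞) (β : Rn n → ℝ)
    (a : ℝ → Rn n → Rn n → Matrix (Fin n) (Fin n) ℝ) (t : ℝ) (v : L2tilde Ω ε) : ℝ≥0∞ :=
  (1 / 2) * ∫⁻ x in tildeDomain Ω ε, ∫⁻ y in tildeDomain Ω ε,
    ENNReal.ofReal (Dstar ε β v x y ⬝ᵥ (a t x y *ᵥ Dstar ε β v x y))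

/-- Membership in the constrained energy space `V_c(Ω̃)`. -/
def MemVc (bc : Constraint) (Ω : Set (Rn n)) (ε : ℝ≥0∞) (β : Rn n → ℝ)
    (a : ℝ → Rn n → Rn n → Matrix (Fin n) (Fin n) ℝ) (T : ℝ) (v : L2tilde Ω ε) : Prop :=
  (∀ t ∈ Icc 0 T, energySq Ω ε β a t v < ⊤) ∧ ConstraintZero bc Ω ε v

/-- The order `β` is continuous on `Ω̃` with `0 < β_* ≤ β ≤ β^* < 1`. -/
def IsOrder (Ω : Set (Rn n)) (ε : ℝ≥0∞) (β : Rn n → ℝ) : Prop :=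
  ContinuousOn β (tildeDomain Ω ε) ∧
    ∃ βlo βhi : ℝ, 0 < βlo ∧ βhi < 1 ∧ ∀ x ∈ tildeDomain Ω ε, βlo ≤ β x ∧ β x ≤ βhi

/-- The assumptions on the diffusion tensor `a`, with ellipticity constants `alo` and `ahi`. -/
structure IsTensor (Ω : Set (Rn n)) (ε : ℝ≥0∞) (T alo ahi : ℝ)
    (a : ℝ → Rn n → Rn n → Matrix (Fin n) (Fin n) ℝ) : Prop where
  contDiffOn : ∀ i j, ContDiffOn ℝ 1
    (fun p : ℝ × Rn n × Rn n => a p.1 p.2.1 p.2.2 i j) (Icc 0 T ×ˢ univ)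
  symm : ∀ t ∈ Icc 0 T, ∀ x y i j, a t x y i j = a t x y j i
  lower : ∀ t ∈ Icc 0 T, ∀ x ∈ tildeDomain Ω ε, ∀ y ∈ tildeDomain Ω ε, edist y x ≤ ε →
    ∀ ξ : Fin n → ℝ, alo * ∑ i, ξ i ^ 2 ≤ ∑ i, ∑ j, a t x y i j * ξ i * ξ j
  upper : ∀ t ∈ Icc 0 T, ∀ x ∈ tildeDomain Ω ε, ∀ y ∈ tildeDomain Ω ε, edist y x ≤ ε →
    ∀ ξ : Fin n → ℝ, ∑ i, ∑ j, a t x y i j * ξ i * ξ j ≤ ahi * ∑ i, ξ i ^ 2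
  deriv_upper : ∀ t ∈ Icc 0 T, ∀ x ∈ tildeDomain Ω ε, ∀ y ∈ tildeDomain Ω ε, edist y x ≤ ε →
    ∀ ξ : Fin n → ℝ,
      ∑ i, ∑ j, derivWithin (fun s => a s x y i j) (Icc 0 T) t * ξ i * ξ j ≤ ahi * ∑ i, ξ i ^ 2

/-- `w'` is the weak derivative of `w` on `(0,T)`. -/
def IsWeakTimeDeriv {X : Type*} [NormedAddCommGroup X] [NormedSpace ℝ X]
    (T : ℝ) (w w' : ℝ → X) : Prop :=
  ∀ φ : ℝ → ℝ, ContDiff ℝ ∞ φ → HasCompactSupport φ → tsupport φ ⊆ Ioo 0 T →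
    ∫ t in Ioo 0 T, deriv φ t • w t = -∫ t in Ioo 0 T, φ t • w' t

/-- The norm of `L²(0,T;X)`. -/
def timeL2Norm {X : Type*} [NormedAddCommGroup X] (T : ℝ) (w : ℝ → X) : ℝ :=
  Real.sqrt (∫ t in Ioo 0 T, ‖w t‖ ^ 2)

/-- `u` solves, in the parabolic variational formulation on `(0,T)` and with zero source, the
nonlocal diffusion equation with the volume constraint `bc`, and `∂ₜu ∈ L²(0,T;L²(Ω))`:
`u ∈ L²(0,T;V_c(Ω̃))`, and for all `φ ∈ V_c(Ω̃)`,
`∫_Ω ∂ₜu φ + ∫_{Ω̃} ∫_{Ω̃} D*(u) · (a · D*(φ)) = 0` for almost every `t`. -/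
structure IsSolution (bc : Constraint) (Ω : Set (Rn n)) (ε : ℝ≥0∞) (β : Rn n → ℝ)
    (a : ℝ → Rn n → Rn n → Matrix (Fin n) (Fin n) ℝ) (T : ℝ) (u : ℝ → L2tilde Ω ε) : Prop where
  memLp : MemLp u 2 (volume.restrict (Ioo 0 T))
  memVc : ∀ᵐ t ∂(volume.restrict (Ioo 0 T)), MemVc bc Ω ε β a T (u t)
  energy_finite : ∫⁻ t in Ioo 0 T, energySq Ω ε β a t (u t) < ⊤
  equation : ∃ u' : ℝ → L2dom Ω ε, MemLp u' 2 (volume.restrict (Ioo 0 T)) ∧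
    IsWeakTimeDeriv T (fun t => resDom Ω ε (u t)) u' ∧
    ∀ φ : L2tilde Ω ε, MemVc bc Ω ε β a T φ →
      ∀ᵐ t ∂(volume.restrict (Ioo 0 T)),
        inner ℝ (u' t) (resDom Ω ε φ) + energyForm Ω ε β a t (u t) φ = 0

/-- `u` is continuous on `(0,T]` with values in `H_c^{β(·)}(Ω̃)`. -/
def ContinuousInHc (bc : Constraint) (Ω : Set (Rn n)) (ε : ℝ≥0∞) (β : Rn n → ℝ)
    (T : ℝ) (u : ℝ → L2tilde Ω ε) : Prop :=
  ∀ t ∈ Ioc 0 T, MemHc bc Ω ε β (u t) ∧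
    Tendsto (fun s => sobolevENorm Ω ε β (u s - u t)) (𝓝[Ioc 0 T] t) (𝓝 0)

/-- The initial value `u(0) ∈ L²_c(Ω̃)` is attained in `L²(Ω)`. -/
def HasInitialValue (bc : Constraint) (Ω : Set (Rn n)) (ε : ℝ≥0∞) (u : ℝ → L2tilde Ω ε) : Prop :=
  ConstraintZero bc Ω ε (u 0) ∧
    Tendsto (fun t => resDom Ω ε (u t)) (𝓝[>] 0) (𝓝 (resDom Ω ε (u 0)))

end

end NonlocalDiffusion

open NonlocalDiffusion

/-! Both estimates come from logarithmic convexity. Let `y t = ‖u t‖²` in `L²(Ω)`, let `B_t` be the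
energy form and `κ = ahi / alo`. Testing with `u` gives `y' = -2 B_t(u,u)`. The bound on `∂ₜa` and
ellipticity give `∂ₜB_t(v,v) ≤ κ B_t(v,v)` for frozen `v`. Formally, then, `y'' ≥ 4‖∂ₜu‖² + κ y'`,
and `y'² ≤ 4‖∂ₜu‖² y` by Cauchy-Schwarz, so `(log y)'' ≥ κ (log y)'`: `log y` is convex in the
variable `exp (κ t)`.

The regularity at hand does not justify computing `y''`. What is available is that `r ↦ ⟨u r, u s⟩`
has derivative `-B_r(u r, u s)` for each fixed `s` (`hasDerivAt_inner_solution`), with a jointly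
continuous right-hand side. This gives `y'` and a one-sided second-order difference inequality
(`two_mul_norm_sub_sq_le`), which suffices to compare `log y` with smooth strict barriers by a
maximum principle (`norm_sq_add_le_exp`). Removing the perturbations gives
`norm_sq_le_rpow_mul_rpow`.

For (i), interpolate between `t₀ / 2` and `T`; since `y` decreases, `y (t₀ / 2)` is controlled by
the space-time norm. For (ii), interpolate between `0` and `T`: the exponent `θ t` is at least `c *
t`, so `y t` is at most a constant times `exp (-2 c t log (1/S))`, where `S` is the Sobolev norm of
`u T`. Integrating in time yields the factor `1 / log (1/S)`, whose square root is the rate. -/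

namespace NonlocalDiffusion

/-! ### Logarithmic convexity for abstract flows in an inner product space -/

section LogConvexity

/-- Second-order Peano expansion, from the right. -/
theorem tendsto_peano_second {z z' : ℝ → ℝ} {c t : ℝ} (hz : ∀ x, HasDerivAt z (z' x) x)
    (hz' : HasDerivAt z' c t) :
    Tendsto (fun k => (z (t + k) - z t - k * z' t) / k ^ 2) (𝓝[>] 0) (𝓝 (c / 2)) := by
  have h1 : ∀ k : ℝ, HasDerivAt (fun k => z (t + k) - z t - k * z' t) (z' (t + k) - z' t) k := by
    intro k
    have := (((hz (t + k)).comp_const_add t k).sub_const (z t)).fun_sub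
      ((hasDerivAt_id' k).mul_const (z' t))
    simpa using this
  have h2 : ∀ k : ℝ, HasDerivAt (fun k : ℝ => k ^ 2) (2 * k) k := by
    intro k
    simpa using hasDerivAt_pow 2 k
  -- Since `z'` is differentiable only at `t`, L'Hôpital is applied once; the resulting quotient is
  -- half the difference quotient of `z'` at `t`.
  refine HasDerivAt.lhopital_zero_nhdsGT (Eventually.of_forall h1) (Eventually.of_forall h2)
    ?_ ?_ ?_ ?_
  · filter_upwards [self_mem_nhdsWithin] with k hk
    have : (0 : ℝ) < k := hk
    positivity
  · have := (h1 0).continuousAt.tendsto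
    simp only [add_zero, sub_self, zero_mul] at this
    exact this.mono_left nhdsWithin_le_nhds
  · have := (h2 0).continuousAt.tendsto
    simp only [ne_eq, OfNat.ofNat_ne_zero, not_false_eq_true, zero_pow] at this
    exact this.mono_left nhdsWithin_le_nhds
  · have h3 := hasDerivAt_iff_tendsto_slope_zero.1 hz'
    have h4 := (h3.mono_left (nhdsWithin_mono 0 (fun x (hx : x ∈ Ioi (0 : ℝ)) =>
      (ne_of_gt hx : x ≠ 0)))).div_const 2
    refine h4.congr fun k => ?_
    simp only [smul_eq_mul]
    rw [mul_comm 2 k, ← div_div, div_eq_inv_mul (z' (t + k) - z' t) k]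

variable {X : Type*} [NormedAddCommGroup X] [InnerProductSpace ℝ X] {T κ : ℝ} {U : ℝ → X}
  {b : ℝ → ℝ → ℝ}

/-- Only inner products with frozen states are differentiable, so the product rule is replaced by
`‖U r‖² = 2⟨U r, U t⟩ - ‖U t‖² + ‖U r - U t‖²`, whose last term is `o(r - t)` by joint continuity of
`b`. -/
theorem hasDerivAt_norm_sq_of_inner
    (hb : ContinuousOn (Function.uncurry b) (Ioo 0 T ×ˢ Ioo 0 T))
    (hd : ∀ s ∈ Ioo 0 T, ∀ r ∈ Ioo 0 T,
      HasDerivAt (fun r => inner ℝ (U r) (U s)) (-(b r s)) r)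
    {t : ℝ} (ht : t ∈ Ioo 0 T) : HasDerivAt (fun r => ‖U r‖ ^ 2) (-2 * b t t) t := by
  have hsmall : HasDerivAt (fun r => ‖U r - U t‖ ^ 2) 0 t := by
    rw [hasDerivAt_iff_isLittleO]
    simp only [sub_self, norm_zero, ne_eq, OfNat.ofNat_ne_zero, not_false_eq_true, zero_pow,
      sub_zero, smul_zero]
    rw [Asymptotics.isLittleO_iff]
    intro c hc
    have hbt : ContinuousAt (Function.uncurry b) (t, t) :=
      hb.continuousAt ((isOpen_Ioo.prod isOpen_Ioo).mem_nhds ⟨ht, ht⟩)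
    obtain ⟨d, hd0, hdb⟩ := Metric.continuousAt_iff.1 hbt (c / 2) (by positivity)
    have hI : ∀ᶠ r in 𝓝 t, r ∈ Ioo 0 T := isOpen_Ioo.mem_nhds ht
    obtain ⟨e, he0, heb⟩ := Metric.eventually_nhds_iff_ball.1 hI
    filter_upwards [Metric.ball_mem_nhds t (lt_min hd0 he0)] with r hr
    have hconv : Convex ℝ (Metric.ball t (min d e)) := convex_ball _ _
    have hrI : r ∈ Ioo 0 T := heb r (Metric.ball_subset_ball (min_le_right _ _) hr)
    -- Mean value inequality for `x ↦ ⟨U x, U r - U t⟩`: its increment from `t` to `r` is exactly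
    -- `‖U r - U t‖²`, and its derivative is small because `b x r` and `b x t` are both close to `b
    -- t t`.
    have key := hconv.norm_image_sub_le_of_norm_hasDerivWithin_le (C := c)
      (f := fun x => inner ℝ (U x) (U r) - inner ℝ (U x) (U t))
      (f' := fun x => -(b x r) - -(b x t)) (x := t) (y := r) ?_ ?_
      (Metric.mem_ball_self (lt_min hd0 he0)) hr
    · have e1 : (inner ℝ (U r) (U r) - inner ℝ (U r) (U t)) -
          (inner ℝ (U t) (U r) - inner ℝ (U t) (U t)) = ‖U r - U t‖ ^ 2 := by
        rw [← real_inner_self_eq_norm_sq, inner_sub_left, inner_sub_right, inner_sub_right]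
      rwa [e1] at key
    · intro x hx
      have hxI : x ∈ Ioo 0 T := heb x (Metric.ball_subset_ball (min_le_right _ _) hx)
      exact ((hd r hrI x hxI).sub (hd t ht x hxI)).hasDerivWithinAt
    · intro x hx
      have hx' := lt_of_lt_of_le (Metric.mem_ball.1 hx) (min_le_left d e)
      have hr' := lt_of_lt_of_le (Metric.mem_ball.1 hr) (min_le_left d e)
      have h1 := hdb (x := (x, r)) (by rw [Prod.dist_eq]; exact max_lt hx' hr')
      have h2 := hdb (x := (x, t)) (by rw [Prod.dist_eq]; exact max_lt hx' (by simpa using hd0))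
      simp only [Function.uncurry_apply_pair, Real.dist_eq] at h1 h2
      rw [Real.norm_eq_abs]
      rw [abs_lt] at h1 h2
      rw [abs_le]
      constructor <;> linarith [h1.1, h1.2, h2.1, h2.2]
  have h := (((hd t ht t ht).const_mul 2).sub_const (‖U t‖ ^ 2)).add hsmall
  rw [show -2 * b t t = 2 * -(b t t) + 0 by ring]
  refine h.congr_of_eventuallyEq (Eventually.of_forall fun r => ?_)
  simp only [Pi.add_apply]
  rw [norm_sub_sq_real]
  ring

/-- A one-sided second-order expansion of `‖U‖²` for a flow whose energy `b t t` grows at most at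
rate `κ` along frozen states. -/
theorem two_mul_norm_sub_sq_le
    (hb : ContinuousOn (Function.uncurry b) (Ioo 0 T ×ˢ Ioo 0 T))
    (hd : ∀ s ∈ Ioo 0 T, ∀ r ∈ Ioo 0 T,
      HasDerivAt (fun r => inner ℝ (U r) (U s)) (-(b r s)) r)
    (hE : ∀ t ∈ Ioo 0 T, ∀ r ∈ Ioo 0 T, t ≤ r →
      b r r - b t t ≤ 2 * (b r r - b r t) + κ * (r - t) * b t t)
    {t r : ℝ} (ht : t ∈ Ioo 0 T) (hr : r ∈ Ioo 0 T) (htr : t ≤ r) :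
    2 * ‖U r - U t‖ ^ 2 ≤
      ‖U r‖ ^ 2 - ‖U t‖ ^ 2 + 2 * (r - t) * b t t + κ * (r - t) ^ 2 * b t t := by
  have hsub : Icc t r ⊆ Ioo 0 T := fun x hx => ⟨ht.1.trans_le hx.1, hx.2.trans_lt hr.2⟩
  -- The claim is `g t ≤ g r`, and `hE` says exactly that `g' ≥ 0`.
  let g : ℝ → ℝ := fun x => 2 * (2 * inner ℝ (U x) (U t)) + 2 * b t t * (x - t) +
    κ * b t t * (x - t) ^ 2 - ‖U x‖ ^ 2
  have hg : ∀ x ∈ Icc t r, HasDerivAt g (2 * (2 * -(b x t)) + 2 * b t t * 1 +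
      κ * b t t * (2 * (x - t)) - -2 * b x x) x := by
    intro x hx
    have h0 : HasDerivAt (fun x => x - t) 1 x := (hasDerivAt_id x).sub_const t
    have h2 : HasDerivAt (fun x => (x - t) ^ 2) (2 * (x - t)) x := by
      simpa using h0.fun_pow 2
    exact (((((hd t ht x (hsub hx)).const_mul 2).const_mul 2).add (h0.const_mul _)).add
      (h2.const_mul _)).sub (hasDerivAt_norm_sq_of_inner hb hd (hsub hx))
  have hmono : MonotoneOn g (Icc t r) := by
    refine monotoneOn_of_deriv_nonneg (convex_Icc t r)
      (fun x hx => (hg x hx).continuousAt.continuousWithinAt)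
      (fun x hx => (hg x (interior_subset hx)).differentiableAt.differentiableWithinAt) ?_
    intro x hx
    have hx' := interior_subset hx
    rw [(hg x hx').deriv]
    have := hE t ht x (hsub hx') hx'.1
    linarith
  have h := hmono (left_mem_Icc.2 htr) (right_mem_Icc.2 htr) htr
  simp only [g, real_inner_self_eq_norm_sq] at h
  rw [norm_sub_sq_real]
  linarith

/-- Comparison principle: `‖U‖² + η` stays below `exp L` when `L'' < κ L'` and this holds at both
end points. -/
theorem norm_sq_add_le_exp
    (hb : ContinuousOn (Function.uncurry b) (Ioo 0 T ×ˢ Ioo 0 T))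
    (hd : ∀ s ∈ Ioo 0 T, ∀ r ∈ Ioo 0 T,
      HasDerivAt (fun r => inner ℝ (U r) (U s)) (-(b r s)) r)
    (hE : ∀ t ∈ Ioo 0 T, ∀ r ∈ Ioo 0 T, t ≤ r →
      b r r - b t t ≤ 2 * (b r r - b r t) + κ * (r - t) * b t t)
    {t₁ : ℝ} (ht₁ : 0 ≤ t₁) (hUc : ContinuousOn (fun t => ‖U t‖ ^ 2) (Icc t₁ T))
    {η : ℝ} (hη : 0 < η) {L L' L'' : ℝ → ℝ} (hL : ∀ x, HasDerivAt L (L' x) x)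
    (hL' : ∀ x, HasDerivAt L' (L'' x) x) (hlt : ∀ x, L'' x < κ * L' x)
    (h₁ : Real.log (‖U t₁‖ ^ 2 + η) ≤ L t₁) (h₂ : Real.log (‖U T‖ ^ 2 + η) ≤ L T)
    {t : ℝ} (ht : t ∈ Icc t₁ T) : ‖U t‖ ^ 2 + η ≤ Real.exp (L t) := by
  have hpos : ∀ x, 0 < ‖U x‖ ^ 2 + η := fun x => by positivity
  have hLc : Continuous L := continuous_iff_continuousAt.2 fun x => (hL x).continuousAt
  have hfc : ContinuousOn (fun x => Real.log (‖U x‖ ^ 2 + η) - L x) (Icc t₁ T) :=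
    ((hUc.add continuousOn_const).log fun x _ => (hpos x).ne').sub hLc.continuousOn
  obtain ⟨τ, hτ, hmax⟩ := isCompact_Icc.exists_isMaxOn ⟨t, ht⟩ hfc
  set c : ℝ := Real.log (‖U τ‖ ^ 2 + η) - L τ with hc
  have hle : ∀ x ∈ Icc t₁ T, Real.log (‖U x‖ ^ 2 + η) - L x ≤ c := fun x hx => hmax hx
  rw [← Real.log_le_iff_le_exp (hpos t)]
  suffices hc0 : c ≤ 0 by linarith [hle t ht]
  by_contra! hc0
  have hτ1 : t₁ < τ := lt_of_le_of_ne hτ.1 (by rintro rfl; linarith)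
  have hτ2 : τ < T := lt_of_le_of_ne hτ.2 (by rintro rfl; linarith)
  have hτI : τ ∈ Ioo 0 T := ⟨ht₁.trans_lt hτ1, hτ2⟩
  -- If the maximum `c` were positive it would be interior; the raised barrier `z` then touches
  -- `‖U‖² + η` from above at `τ`, so first derivatives agree there and second-order increments are
  -- ordered.
  let z : ℝ → ℝ := fun x => Real.exp (L x + c)
  have hz : ∀ x, HasDerivAt z (z x * L' x) x := fun x => ((hL x).add_const c).exp
  have hz' : HasDerivAt (fun x => z x * L' x) (z τ * L' τ * L' τ + z τ * L'' τ) τ :=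
    (hz τ).mul (hL' τ)
  have hzτ : ‖U τ‖ ^ 2 + η = z τ := by
    simp only [z, hc]
    rw [show L τ + (Real.log (‖U τ‖ ^ 2 + η) - L τ) = Real.log (‖U τ‖ ^ 2 + η) by ring,
      Real.exp_log (hpos τ)]
  have hyz : ∀ x ∈ Icc t₁ T, ‖U x‖ ^ 2 + η ≤ z x := fun x hx => by
    rw [← Real.log_le_iff_le_exp (hpos x)]
    linarith [hle x hx]
  have hy' := hasDerivAt_norm_sq_of_inner hb hd hτI
  have hEz : -2 * b τ τ = z τ * L' τ := by
    have hloc : IsLocalMax (fun x => ‖U x‖ ^ 2 - z x) τ := by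
      filter_upwards [Icc_mem_nhds hτ1 hτ2] with x hx
      linarith [hyz x hx]
    have := hloc.hasDerivAt_eq_zero (hy'.sub (hz τ))
    linarith
  have hlim₁ := (tendsto_peano_second hz hz').add_const (κ * b τ τ)
  have hlim₂ : Tendsto (fun k => 2 * ((inner ℝ (U (τ + k)) (U τ) - inner ℝ (U τ) (U τ)) / k) ^ 2)
      (𝓝[>] 0) (𝓝 (2 * (-(b τ τ)) ^ 2)) := by
    have h3 := hasDerivAt_iff_tendsto_slope_zero.1 (hd τ hτI τ hτI)
    have h4 := h3.mono_left (nhdsWithin_mono 0 (fun x (hx : x ∈ Ioi (0 : ℝ)) =>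
      (ne_of_gt hx : x ≠ 0)))
    refine ((h4.pow 2).const_mul 2).congr fun k => ?_
    rw [smul_eq_mul, div_eq_inv_mul]
  -- The limit reads `2 b² ≤ z (z'' / 2 + κ b)` at `τ`. With `b = -z L' / 2` and `z'' = z (L'² +
  -- L'')` it becomes `κ L' ≤ L''`, against `hlt`.
  have hfin := le_of_tendsto_of_tendsto hlim₂ (hlim₁.const_mul (z τ)) ?_
  · have hzpos : 0 < z τ := Real.exp_pos _
    have hb' : b τ τ = -(z τ * L' τ) / 2 := by linarith
    rw [hb'] at hfin
    have hl := hlt τ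
    have : 0 < z τ ^ 2 * (κ * L' τ - L'' τ) := by
      have : 0 < κ * L' τ - L'' τ := by linarith
      positivity
    nlinarith
  · have hT : ∀ᶠ k in 𝓝[>] (0 : ℝ), k < T - τ :=
      nhdsWithin_le_nhds (Iio_mem_nhds (by linarith))
    filter_upwards [self_mem_nhdsWithin, hT] with k hk hkT
    have hk0 : 0 < k := hk
    have hkI : τ + k ∈ Ioo 0 T := ⟨by linarith [hτI.1], by linarith⟩
    have hmain := two_mul_norm_sub_sq_le hb hd hE hτI hkI (by linarith)
    -- Discrete form of `⟨∂ₜU, U⟩² ≤ ‖∂ₜU‖² ‖U‖²`; no strong derivative of `U` is needed.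
    have hcs : (inner ℝ (U (τ + k)) (U τ) - inner ℝ (U τ) (U τ)) ^ 2 ≤
        z τ * ‖U (τ + k) - U τ‖ ^ 2 := by
      rw [← inner_sub_left]
      have h5 := abs_real_inner_le_norm (U (τ + k) - U τ) (U τ)
      have h6 : (inner ℝ (U (τ + k) - U τ) (U τ)) ^ 2 ≤ (‖U (τ + k) - U τ‖ * ‖U τ‖) ^ 2 := by
        rw [← sq_abs (inner ℝ (U (τ + k) - U τ) (U τ))]
        gcongr
      calc _ ≤ _ := h6
        _ = ‖U τ‖ ^ 2 * ‖U (τ + k) - U τ‖ ^ 2 := by ring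
        _ ≤ _ := by gcongr; linarith
    have h7 := hyz (τ + k) ⟨by linarith, by linarith⟩
    simp only [add_sub_cancel_left] at hmain
    have h8 : 2 * ‖U (τ + k) - U τ‖ ^ 2 ≤
        z (τ + k) - z τ - k * (z τ * L' τ) + κ * k ^ 2 * b τ τ := by
      rw [← hEz]; linarith
    have hzpos : 0 < z τ := Real.exp_pos _
    rw [div_pow, mul_div_assoc', div_le_iff₀ (by positivity)]
    calc 2 * (inner ℝ (U (τ + k)) (U τ) - inner ℝ (U τ) (U τ)) ^ 2
        ≤ z τ * (2 * ‖U (τ + k) - U τ‖ ^ 2) := by linarith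
      _ ≤ z τ * (z (τ + k) - z τ - k * (z τ * L' τ) + κ * k ^ 2 * b τ τ) := by gcongr
      _ = _ := by field_simp

/-- `log ‖U‖²` is a convex function of `exp (κ t)`. -/
theorem norm_sq_le_rpow_mul_rpow (hκ : 0 < κ)
    (hb : ContinuousOn (Function.uncurry b) (Ioo 0 T ×ˢ Ioo 0 T))
    (hd : ∀ s ∈ Ioo 0 T, ∀ r ∈ Ioo 0 T,
      HasDerivAt (fun r => inner ℝ (U r) (U s)) (-(b r s)) r)
    (hE : ∀ t ∈ Ioo 0 T, ∀ r ∈ Ioo 0 T, t ≤ r →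
      b r r - b t t ≤ 2 * (b r r - b r t) + κ * (r - t) * b t t)
    {t₁ : ℝ} (ht₁ : 0 ≤ t₁) (ht₁T : t₁ < T)
    (hUc : ContinuousOn (fun t => ‖U t‖ ^ 2) (Icc t₁ T))
    {t θ : ℝ} (ht : t ∈ Icc t₁ T)
    (hθ : θ = (Real.exp (κ * t) - Real.exp (κ * t₁)) / (Real.exp (κ * T) - Real.exp (κ * t₁))) :
    ‖U t‖ ^ 2 ≤ (‖U t₁‖ ^ 2) ^ (1 - θ) * (‖U T‖ ^ 2) ^ θ := by
  have hden : 0 < Real.exp (κ * T) - Real.exp (κ * t₁) := by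
    have : Real.exp (κ * t₁) < Real.exp (κ * T) := Real.exp_lt_exp.2 (by gcongr)
    linarith
  have hθ0 : 0 ≤ θ := by
    rw [hθ]
    have : Real.exp (κ * t₁) ≤ Real.exp (κ * t) := Real.exp_le_exp.2 (by gcongr; exact ht.1)
    exact div_nonneg (by linarith) hden.le
  have hθ1 : θ ≤ 1 := by
    rw [hθ, div_le_one hden]
    have : Real.exp (κ * t) ≤ Real.exp (κ * T) := Real.exp_le_exp.2 (by gcongr; exact ht.2)
    linarith
  -- The shift `η` keeps the logarithm finite where `U` vanishes; it is sent to zero at the end.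
  have main : ∀ η : ℝ, 0 < η →
      ‖U t‖ ^ 2 + η ≤ (‖U t₁‖ ^ 2 + η) ^ (1 - θ) * (‖U T‖ ^ 2 + η) ^ θ := by
    intro η hη
    have hp₁ : 0 < ‖U t₁‖ ^ 2 + η := by positivity
    have hp₂ : 0 < ‖U T‖ ^ 2 + η := by positivity
    set l₁ := Real.log (‖U t₁‖ ^ 2 + η) with hl₁
    set l₂ := Real.log (‖U T‖ ^ 2 + η) with hl₂
    let B : ℝ := (l₂ - l₁) / (Real.exp (κ * T) - Real.exp (κ * t₁))
    have hB : B * (Real.exp (κ * T) - Real.exp (κ * t₁)) = l₂ - l₁ := div_mul_cancel₀ _ hden.ne'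
    have hBt : B * (Real.exp (κ * t) - Real.exp (κ * t₁)) = θ * (l₂ - l₁) := by
      rw [hθ]; simp only [B]; ring
    -- The barrier affine in `exp (κ x)` solves `L'' = κ L'` exactly; the extra slope `σ` makes the
    -- inequality strict and is sent to zero.
    have step : ∀ σ : ℝ, 0 < σ →
        ‖U t‖ ^ 2 + η ≤ Real.exp ((1 - θ) * l₁ + θ * l₂ + σ * (t - t₁)) := by
      intro σ hσ
      have hexp : ∀ x : ℝ, HasDerivAt (fun x => Real.exp (κ * x)) (κ * Real.exp (κ * x)) x := by
        intro x
        simpa [mul_comm] using ((hasDerivAt_id x).const_mul κ).exp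
      have h := norm_sq_add_le_exp hb hd hE ht₁ hUc hη
        (L := fun x => l₁ + B * (Real.exp (κ * x) - Real.exp (κ * t₁)) + σ * (x - t₁))
        (L' := fun x => B * (κ * Real.exp (κ * x)) + σ)
        (L'' := fun x => B * (κ * (κ * Real.exp (κ * x))))
        (fun x => by
          simpa using ((((hexp x).sub_const _).const_mul B).const_add l₁).fun_add
            (((hasDerivAt_id' x).sub_const t₁).const_mul σ))
        (fun x => (((hexp x).const_mul κ).const_mul B).add_const σ)
        (fun x => by
          have : 0 < κ * σ := mul_pos hκ hσ
          linarith)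
        (by simp [hl₁])
        (by
          have : 0 < σ * (T - t₁) := mul_pos hσ (by linarith)
          linarith) ht
      refine h.trans (le_of_eq ?_)
      rw [hBt]
      congr 1
      ring
    have hexp_eq : Real.exp ((1 - θ) * l₁ + θ * l₂) =
        (‖U t₁‖ ^ 2 + η) ^ (1 - θ) * (‖U T‖ ^ 2 + η) ^ θ := by
      rw [Real.exp_add, Real.rpow_def_of_pos hp₁, Real.rpow_def_of_pos hp₂, mul_comm (1 - θ),
        mul_comm θ]
    rw [← hexp_eq]
    have hcont : Continuous fun σ : ℝ =>
        Real.exp ((1 - θ) * l₁ + θ * l₂ + σ * (t - t₁)) := by fun_prop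
    have hlim := (hcont.tendsto 0).mono_left (nhdsWithin_le_nhds (s := Ioi 0))
    simp only [zero_mul, add_zero] at hlim
    exact ge_of_tendsto hlim (by filter_upwards [self_mem_nhdsWithin] with σ hσ using step σ hσ)
  have hc₁ : Continuous fun η : ℝ =>
      (‖U t₁‖ ^ 2 + η) ^ (1 - θ) * (‖U T‖ ^ 2 + η) ^ θ :=
    ((continuous_const.add continuous_id).rpow_const fun _ => Or.inr (by linarith)).mul
      ((continuous_const.add continuous_id).rpow_const fun _ => Or.inr hθ0)
  have hc₂ : Continuous fun η : ℝ => ‖U t‖ ^ 2 + η := by fun_prop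
  have hl₁ := (hc₁.tendsto 0).mono_left (nhdsWithin_le_nhds (s := Ioi 0))
  have hl₂ := (hc₂.tendsto 0).mono_left (nhdsWithin_le_nhds (s := Ioi 0))
  simp only [add_zero] at hl₁ hl₂
  exact le_of_tendsto_of_tendsto hl₂ hl₁
    (by filter_upwards [self_mem_nhdsWithin] with η hη using main η hη)

theorem antitoneOn_norm_sq
    (hb : ContinuousOn (Function.uncurry b) (Ioo 0 T ×ˢ Ioo 0 T))
    (hd : ∀ s ∈ Ioo 0 T, ∀ r ∈ Ioo 0 T,
      HasDerivAt (fun r => inner ℝ (U r) (U s)) (-(b r s)) r)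
    (hpos : ∀ t ∈ Ioo 0 T, 0 ≤ b t t) : AntitoneOn (fun t => ‖U t‖ ^ 2) (Ioo 0 T) := by
  have h := fun t (ht : t ∈ Ioo 0 T) => hasDerivAt_norm_sq_of_inner hb hd ht
  refine antitoneOn_of_deriv_nonpos (convex_Ioo 0 T)
    (fun t ht => (h t ht).continuousAt.continuousWithinAt)
    (fun t ht => (h t (interior_subset ht)).differentiableAt.differentiableWithinAt) ?_
  intro t ht
  rw [(h t (interior_subset ht)).deriv]
  linarith [hpos t (interior_subset ht)]

end LogConvexity

/-! ### From weak to classical derivatives on an interval -/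

section WeakDerivative

theorem continuous_mul_of_tsupport_subset {φ g : ℝ → ℝ} {s : Set ℝ} (hs : IsOpen s)
    (hφ : Continuous φ) (hφs : tsupport φ ⊆ s) (hg : ContinuousOn g s) :
    Continuous fun x => φ x * g x := by
  rw [continuous_iff_continuousAt]
  intro x
  by_cases hx : x ∈ s
  · exact hφ.continuousAt.mul (hg.continuousAt (hs.mem_nhds hx))
  · have h0 : (fun x => φ x * g x) =ᶠ[𝓝 x] fun _ => 0 := by
      filter_upwards [notMem_tsupport_iff_eventuallyEq.1 fun h => hx (hφs h)] with y hy
      simp [hy]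
    exact continuousAt_const.congr h0.symm

theorem integrable_mul_of_tsupport_subset {φ g : ℝ → ℝ} {s : Set ℝ} (hs : IsOpen s)
    (hφ : Continuous φ) (hφc : HasCompactSupport φ) (hφs : tsupport φ ⊆ s)
    (hg : ContinuousOn g s) : Integrable fun x => φ x * g x :=
  (continuous_mul_of_tsupport_subset hs hφ hφs hg).integrable_of_hasCompactSupport
    hφc.mul_right

theorem setIntegral_mul_eq_of_tsupport_subset {φ g : ℝ → ℝ} {s : Set ℝ} (hφs : tsupport φ ⊆ s) :
    ∫ x in s, φ x * g x = ∫ x, φ x * g x :=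
  setIntegral_eq_integral_of_forall_compl_eq_zero fun x hx => by
    rw [image_eq_zero_of_notMem_tsupport fun h => hx (hφs h), zero_mul]

theorem integral_deriv_mul_eq_neg {φ W g : ℝ → ℝ} {s : Set ℝ} (hs : IsOpen s)
    (hφ : ContDiff ℝ 1 φ) (hφc : HasCompactSupport φ) (hφs : tsupport φ ⊆ s)
    (hg : ContinuousOn g s) (hW : ∀ x ∈ s, HasDerivAt W (g x) x) :
    ∫ x, deriv φ x * W x = -∫ x, φ x * g x := by
  have hWc : ContinuousOn W s := fun x hx => (hW x hx).continuousAt.continuousWithinAt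
  have hφ' : Continuous (deriv φ) := hφ.continuous_deriv le_rfl
  have hs' : tsupport (deriv φ) ⊆ s := (tsupport_deriv_subset).trans hφs
  have h1 := integrable_mul_of_tsupport_subset hs hφ' hφc.deriv hs' hWc
  have h2 := integrable_mul_of_tsupport_subset hs hφ.continuous hφc hφs hg
  have h3 := integrable_mul_of_tsupport_subset hs hφ.continuous hφc hφs hWc
  have hder : ∀ x, HasDerivAt (fun x => φ x * W x) (deriv φ x * W x + φ x * g x) x := by
    intro x
    by_cases hx : x ∈ s
    · exact ((hφ.differentiable one_ne_zero x).hasDerivAt).fun_mul (hW x hx)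
    · have hnt : x ∉ tsupport φ := fun h => hx (hφs h)
      have h0 : (fun x => φ x * W x) =ᶠ[𝓝 x] fun _ => 0 := by
        filter_upwards [notMem_tsupport_iff_eventuallyEq.1 hnt] with y hy
        simp [hy]
      rw [image_eq_zero_of_notMem_tsupport hnt,
        image_eq_zero_of_notMem_tsupport fun h => hnt (tsupport_deriv_subset h)]
      simpa using (hasDerivAt_const x (0 : ℝ)).congr_of_eventuallyEq h0
  have h := integral_eq_zero_of_hasDerivAt_of_integrable hder (h1.add h2) h3
  rw [integral_add h1 h2] at h
  linarith

/-- A continuous function on an interval whose weak derivative vanishes is constant. -/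
theorem exists_eq_const_of_integral_deriv_mul_eq_zero {p q : ℝ} (hpq : p < q) {z : ℝ → ℝ}
    (hz : ContinuousOn z (Ioo p q))
    (h : ∀ φ : ℝ → ℝ, ContDiff ℝ ∞ φ → HasCompactSupport φ → tsupport φ ⊆ Ioo p q →
      ∫ x, deriv φ x * z x = 0) :
    ∃ c, ∀ x ∈ Ioo p q, z x = c := by
  have hmid : (p + q) / 2 ∈ Ioo p q := ⟨by linarith, by linarith⟩
  obtain ⟨ρ, hρs, hρc, hρd, hρ0, hρ1⟩ :=
    exists_contDiff_tsupport_subset (n := ⊤) (isOpen_Ioo.mem_nhds hmid)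
  have hρI : 0 < ∫ x, ρ x := by
    refine hρd.continuous.integral_pos_of_hasCompactSupport_nonneg_nonzero hρc
      (fun x => (hρ0 ⟨x, rfl⟩).1) (x := (p + q) / 2) ?_
    rw [hρ1]; exact one_ne_zero
  set m : ℝ := ∫ x, ρ x with hm
  refine ⟨(∫ x, ρ x * z x) / m, ?_⟩
  have hae : ∀ᵐ x, x ∈ Ioo p q → z x - (∫ x, ρ x * z x) / m = 0 := by
    refine isOpen_Ioo.ae_eq_zero_of_integral_contDiff_smul_eq_zero
      ((hz.sub continuousOn_const).locallyIntegrableOn measurableSet_Ioo) ?_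
    intro ψ hψd hψc hψs
    have hψi : Integrable ψ := hψd.continuous.integrable_of_hasCompactSupport hψc
    have hρi : Integrable ρ := hρd.continuous.integrable_of_hasCompactSupport hρc
    have hψz := integrable_mul_of_tsupport_subset isOpen_Ioo hψd.continuous hψc hψs hz
    have hρz := integrable_mul_of_tsupport_subset isOpen_Ioo hρd.continuous hρc hρs hz
    -- Subtracting a multiple of the fixed bump `ρ` makes the mean zero, so the primitive of `χ` is
    -- again a compactly supported test function.
    let χ : ℝ → ℝ := fun x => ψ x - (∫ y, ψ y) / m * ρ x
    have hχd : ContDiff ℝ ∞ χ := hψd.sub (contDiff_const.mul hρd)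
    have hχi : Integrable χ := hψi.sub (hρi.const_mul _)
    have hχ0 : ∫ x, χ x = 0 := by
      simp only [χ]
      rw [integral_sub hψi (hρi.const_mul _), integral_const_mul, ← hm]
      field_simp
      ring
    obtain ⟨a, b, hpa, hbq, hab⟩ : ∃ a b, p < a ∧ b < q ∧ ∀ x, x ∉ Icc a b → χ x = 0 := by
      have hK : IsCompact (tsupport ψ ∪ tsupport ρ) := hψc.isCompact.union hρc.isCompact
      have hKs : tsupport ψ ∪ tsupport ρ ⊆ Ioo p q := union_subset hψs hρs
      have hne : (tsupport ψ ∪ tsupport ρ).Nonempty :=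
        ⟨(p + q) / 2, Or.inr (subset_tsupport _ (by
          rw [Function.mem_support, hρ1]; exact one_ne_zero))⟩
      obtain ⟨a, ha, hal⟩ := hK.exists_isLeast hne
      obtain ⟨b, hb, hbl⟩ := hK.exists_isGreatest hne
      refine ⟨a, b, (hKs ha).1, (hKs hb).2, fun x hx => ?_⟩
      have hx' : x ∉ tsupport ψ ∪ tsupport ρ := fun h => hx ⟨hal h, hbl h⟩
      simp only [χ]
      rw [image_eq_zero_of_notMem_tsupport fun h => hx' (Or.inl h),
        image_eq_zero_of_notMem_tsupport fun h => hx' (Or.inr h)]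
      simp
    let φ : ℝ → ℝ := fun x => ∫ y in p..x, χ y
    have hφ' : ∀ x, HasDerivAt φ (χ x) x := fun x =>
      intervalIntegral.integral_hasDerivAt_right (hχi.intervalIntegrable)
        (hχd.continuous.stronglyMeasurableAtFilter _ _) hχd.continuous.continuousAt
    have hφ'eq : deriv φ = χ := funext fun x => (hφ' x).deriv
    have hφd : ContDiff ℝ ∞ φ :=
      contDiff_infty_iff_deriv.2 ⟨fun x => (hφ' x).differentiableAt, hφ'eq ▸ hχd⟩
    have hφsupp : Function.support φ ⊆ Icc a b := by
      intro x hx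
      by_contra hxab
      apply hx
      simp only [φ]
      rcases lt_or_ge x a with hxa | hxa
      · refine intervalIntegral.integral_zero_ae (Eventually.of_forall fun y hy => hab y ?_)
        intro hy'
        rcases mem_uIoc.1 hy with h | h
        · linarith [hy'.1, h.2]
        · linarith [hy'.1, h.2]
      · have hxb : b < x := not_le.1 fun h => hxab ⟨hxa, h⟩
        rw [intervalIntegral.integral_of_le (by linarith), ← hχ0]
        refine setIntegral_eq_integral_of_forall_compl_eq_zero fun y hy => hab y fun hy' => hy ?_
        exact ⟨by linarith [hy'.1], by linarith [hy'.2]⟩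
    have hφts : tsupport φ ⊆ Icc a b := closure_minimal hφsupp isClosed_Icc
    have h0 := h φ hφd (HasCompactSupport.of_support_subset_isCompact isCompact_Icc hφsupp)
      (hφts.trans fun x hx => ⟨by linarith [hx.1], by linarith [hx.2]⟩)
    rw [hφ'eq] at h0
    have e1 : ∀ x, χ x * z x = ψ x * z x - (∫ y, ψ y) / m * (ρ x * z x) := fun x => by
      simp only [χ]; ring
    simp only [e1] at h0
    rw [integral_sub hψz (hρz.const_mul _), integral_const_mul] at h0
    simp only [smul_eq_mul, mul_sub]
    rw [integral_sub hψz (hψi.mul_const _), integral_mul_const]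
    rw [← h0]
    ring
  have hEq := Measure.eqOn_open_of_ae_eq (μ := volume) (U := Ioo p q) (f := z)
    (g := fun _ => (∫ x, ρ x * z x) / m) ?_ isOpen_Ioo hz continuousOn_const
  · exact hEq
  · rw [EventuallyEq, ae_restrict_iff' measurableSet_Ioo]
    filter_upwards [hae] with x hx hxI
    linarith [hx hxI]

/-- A continuous function with a continuous weak derivative is differentiable. -/
theorem hasDerivAt_of_integral_deriv_mul_eq {p q : ℝ} {w g : ℝ → ℝ}
    (hw : ContinuousOn w (Ioo p q)) (hg : ContinuousOn g (Ioo p q))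
    (h : ∀ φ : ℝ → ℝ, ContDiff ℝ ∞ φ → HasCompactSupport φ → tsupport φ ⊆ Ioo p q →
      ∫ x in Ioo p q, deriv φ x * w x = -∫ x in Ioo p q, φ x * g x)
    {x : ℝ} (hx : x ∈ Ioo p q) : HasDerivAt w (g x) x := by
  have hpq : p < q := hx.1.trans hx.2
  -- A classical primitive of `g`: the difference `w - W` has zero weak derivative, hence is
  -- constant.
  let W : ℝ → ℝ := fun y => ∫ s in x..y, g s
  have hW : ∀ y ∈ Ioo p q, HasDerivAt W (g y) y := by
    intro y hy
    have hsub : uIcc x y ⊆ Ioo p q := (ordConnected_Ioo).uIcc_subset hx hy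
    exact intervalIntegral.integral_hasDerivAt_right (hg.mono hsub).intervalIntegrable
      (hg.stronglyMeasurableAtFilter isOpen_Ioo y hy) (hg.continuousAt (isOpen_Ioo.mem_nhds hy))
  have hWc : ContinuousOn W (Ioo p q) := fun y hy => (hW y hy).continuousAt.continuousWithinAt
  obtain ⟨c, hc⟩ := exists_eq_const_of_integral_deriv_mul_eq_zero hpq (hw.sub hWc) (by
    intro φ hφ hφc hφs
    have hφ1 : ContDiff ℝ 1 φ := hφ.of_le (by exact_mod_cast le_top)
    have hs' : tsupport (deriv φ) ⊆ Ioo p q := tsupport_deriv_subset.trans hφs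
    have hcd : Continuous (deriv φ) := hφ1.continuous_deriv le_rfl
    have h1 := h φ hφ hφc hφs
    rw [setIntegral_mul_eq_of_tsupport_subset hs', setIntegral_mul_eq_of_tsupport_subset hφs] at h1
    have h2 := integral_deriv_mul_eq_neg isOpen_Ioo hφ1 hφc hφs hg hW
    simp only [Pi.sub_apply, mul_sub]
    rw [integral_sub (integrable_mul_of_tsupport_subset isOpen_Ioo hcd hφc.deriv hs' hw)
      (integrable_mul_of_tsupport_subset isOpen_Ioo hcd hφc.deriv hs' hWc), h1, h2, sub_self])
  have hev : w =ᶠ[𝓝 x] fun y => W y + c := by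
    filter_upwards [isOpen_Ioo.mem_nhds hx] with y hy
    have := hc y hy
    simp only [Pi.sub_apply] at this
    linarith
  exact ((hW x hx).add_const c).congr_of_eventuallyEq hev

end WeakDerivative

/-! ### Quadratic forms with a kernel dominated by a weight -/

section WeightedForms

variable {Z : Type*} [MeasurableSpace Z] {P : Measure Z}

theorem integrable_mul_mul_of_le {f g k R : Z → ℝ} {M : ℝ}
    (hf : AEStronglyMeasurable f P) (hg : AEStronglyMeasurable g P)
    (hk : AEStronglyMeasurable k P) (hkR : ∀ᵐ z ∂P, 0 ≤ k z ∧ k z ≤ M * R z)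
    (hfR : Integrable (fun z => f z ^ 2 * R z) P) (hgR : Integrable (fun z => g z ^ 2 * R z) P) :
    Integrable (fun z => f z * g z * k z) P := by
  refine Integrable.mono' ((hfR.add hgR).const_mul M) ((hf.mul hg).mul hk) ?_
  filter_upwards [hkR] with z hz
  rw [Real.norm_eq_abs, abs_mul, abs_of_nonneg hz.1]
  have h1 : |f z * g z| ≤ f z ^ 2 + g z ^ 2 := by
    rw [abs_le]
    constructor <;> nlinarith [sq_nonneg (f z + g z), sq_nonneg (f z - g z)]
  calc |f z * g z| * k z ≤ (f z ^ 2 + g z ^ 2) * (M * R z) := by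
        gcongr
        exacts [hz.1, hz.2]
    _ = _ := by simp only [Pi.add_apply]; ring

theorem integrable_sub_sq_mul {f g R : Z → ℝ} (hR : ∀ z, 0 ≤ R z)
    (hf : AEStronglyMeasurable f P) (hg : AEStronglyMeasurable g P)
    (hRm : AEStronglyMeasurable R P)
    (hfR : Integrable (fun z => f z ^ 2 * R z) P) (hgR : Integrable (fun z => g z ^ 2 * R z) P) :
    Integrable (fun z => (f z - g z) ^ 2 * R z) P := by
  refine Integrable.mono' ((hfR.add hgR).const_mul 2) (((hf.sub hg).pow 2).mul hRm) ?_
  refine Eventually.of_forall fun z => ?_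
  rw [Real.norm_eq_abs, abs_of_nonneg (mul_nonneg (sq_nonneg _) (hR z))]
  have h1 : (f z - g z) ^ 2 ≤ 2 * (f z ^ 2 + g z ^ 2) := by
    nlinarith [sq_nonneg (f z + g z)]
  calc (f z - g z) ^ 2 * R z ≤ 2 * (f z ^ 2 + g z ^ 2) * R z := by
        gcongr
        exact hR z
    _ = _ := by simp only [Pi.add_apply]; ring

/-- Cauchy-Schwarz for the semi-inner product with density `k`, through the discriminant of `x ↦ ∫
(f + x g)² k ≥ 0`, followed by `k ≤ M R`. -/
theorem abs_integral_mul_mul_le {f g k R : Z → ℝ} {M : ℝ} (hM : 0 ≤ M) (hR : ∀ z, 0 ≤ R z)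
    (hf : AEStronglyMeasurable f P) (hg : AEStronglyMeasurable g P)
    (hk : AEStronglyMeasurable k P) (hkR : ∀ᵐ z ∂P, 0 ≤ k z ∧ k z ≤ M * R z)
    (hfR : Integrable (fun z => f z ^ 2 * R z) P) (hgR : Integrable (fun z => g z ^ 2 * R z) P) :
    |∫ z, f z * g z * k z ∂P| ≤
      M * √(∫ z, f z ^ 2 * R z ∂P) * √(∫ z, g z ^ 2 * R z ∂P) := by
  have hff := integrable_mul_mul_of_le hf hf hk hkR hfR hfR
  have hfg := integrable_mul_mul_of_le hf hg hk hkR hfR hgR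
  have hgg := integrable_mul_mul_of_le hg hg hk hkR hgR hgR
  have hdisc := discrim_le_zero (a := ∫ z, g z * g z * k z ∂P)
    (b := 2 * ∫ z, f z * g z * k z ∂P) (c := ∫ z, f z * f z * k z ∂P) (fun x => by
      rw [← integral_mul_const, ← integral_const_mul, ← integral_mul_const,
        ← integral_add (hgg.mul_const _) ((hfg.const_mul 2).mul_const x),
        ← integral_add ((hgg.mul_const _).fun_add ((hfg.const_mul 2).mul_const x)) hff]
      refine integral_nonneg_of_ae ?_
      filter_upwards [hkR] with z hz
      have : 0 ≤ (f z + x * g z) ^ 2 * k z := mul_nonneg (sq_nonneg _) hz.1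
      simp only [Pi.zero_apply]
      linarith)
  have hbound : ∀ {h : Z → ℝ}, Integrable (fun z => h z * h z * k z) P →
      Integrable (fun z => h z ^ 2 * R z) P →
      ∫ z, h z * h z * k z ∂P ≤ M * ∫ z, h z ^ 2 * R z ∂P := by
    intro h h1 h2
    rw [← integral_const_mul]
    refine integral_mono_ae h1 (h2.const_mul M) ?_
    filter_upwards [hkR] with z hz
    have : h z ^ 2 * k z ≤ h z ^ 2 * (M * R z) := by
      gcongr
      exact hz.2
    linarith
  have hnn : ∀ h : Z → ℝ, 0 ≤ ∫ z, h z ^ 2 * R z ∂P := fun h =>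
    integral_nonneg fun z => mul_nonneg (sq_nonneg _) (hR z)
  have hffn : 0 ≤ ∫ z, f z * f z * k z ∂P := by
    refine integral_nonneg_of_ae ?_
    filter_upwards [hkR] with z hz using mul_nonneg (mul_self_nonneg _) hz.1
  refine abs_le_of_sq_le_sq ?_ (by positivity)
  rw [mul_pow, mul_pow, Real.sq_sqrt (hnn f), Real.sq_sqrt (hnn g)]
  have hprod : (∫ z, f z * f z * k z ∂P) * (∫ z, g z * g z * k z ∂P) ≤
      (M * ∫ z, f z ^ 2 * R z ∂P) * (M * ∫ z, g z ^ 2 * R z ∂P) := by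
    refine mul_le_mul (hbound hff hfR) (hbound hgg hgR) ?_ (mul_nonneg hM (hnn f))
    refine integral_nonneg_of_ae ?_
    filter_upwards [hkR] with z hz using mul_nonneg (mul_self_nonneg _) hz.1
  rw [discrim] at hdisc
  nlinarith

variable {T M : ℝ} {k D : ℝ → Z → ℝ} {R : Z → ℝ}

/-- Increments are continuous in the `R`-weighted `L²` sense, but the kernel only pointwise in time.
Expanding `D r` and `D s` about the base point leaves three terms small by Cauchy-Schwarz and one
with frozen increments, handled by dominated convergence. -/
theorem continuousOn_integral_mul_mul (hM : 0 ≤ M) (hR : ∀ z, 0 ≤ R z)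
    (hRm : AEStronglyMeasurable R P)
    (hk : ∀ t ∈ Ioo 0 T, AEStronglyMeasurable (k t) P)
    (hkR : ∀ᵐ z ∂P, ∀ t ∈ Ioo 0 T, 0 ≤ k t z ∧ k t z ≤ M * R z)
    (hkc : ∀ᵐ z ∂P, ContinuousOn (fun t => k t z) (Ioo 0 T))
    (hD : ∀ t ∈ Ioo 0 T, AEStronglyMeasurable (D t) P)
    (hDR : ∀ t ∈ Ioo 0 T, Integrable (fun z => D t z ^ 2 * R z) P)
    (hDt : ∀ t ∈ Ioo 0 T,
      Tendsto (fun s => ∫ z, (D s z - D t z) ^ 2 * R z ∂P) (𝓝 t) (𝓝 0)) :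
    ContinuousOn (Function.uncurry fun r s => ∫ z, D r z * D s z * k r z ∂P)
      (Ioo 0 T ×ˢ Ioo 0 T) := by
  rintro ⟨r₀, s₀⟩ ⟨hr₀ : r₀ ∈ Ioo 0 T, hs₀ : s₀ ∈ Ioo 0 T⟩
  apply ContinuousAt.continuousWithinAt
  have hkt : ∀ t ∈ Ioo 0 T, ∀ᵐ z ∂P, 0 ≤ k t z ∧ k t z ≤ M * R z := fun t ht => by
    filter_upwards [hkR] with z hz using hz t ht
  have hfst : Tendsto (Prod.fst : ℝ × ℝ → ℝ) (𝓝 (r₀, s₀)) (𝓝 r₀) := continuousAt_fst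
  have hsnd : Tendsto (Prod.snd : ℝ × ℝ → ℝ) (𝓝 (r₀, s₀)) (𝓝 s₀) := continuousAt_snd
  have hrI : ∀ᶠ q : ℝ × ℝ in 𝓝 (r₀, s₀), q.1 ∈ Ioo 0 T :=
    hfst.eventually (isOpen_Ioo.mem_nhds hr₀)
  have hsI : ∀ᶠ q : ℝ × ℝ in 𝓝 (r₀, s₀), q.2 ∈ Ioo 0 T :=
    hsnd.eventually (isOpen_Ioo.mem_nhds hs₀)
  have hδ : ∀ {a b : ℝ}, a ∈ Ioo 0 T → b ∈ Ioo 0 T →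
      Integrable (fun z => (D a z - D b z) ^ 2 * R z) P := fun ha hb =>
    integrable_sub_sq_mul hR (hD _ ha) (hD _ hb) hRm (hDR _ ha) (hDR _ hb)
  have hJ₁ : Tendsto (fun q : ℝ × ℝ => √(∫ z, (D q.1 z - D r₀ z) ^ 2 * R z ∂P))
      (𝓝 (r₀, s₀)) (𝓝 0) := by
    simpa using ((hDt r₀ hr₀).comp hfst).sqrt
  have hJ₂ : Tendsto (fun q : ℝ × ℝ => √(∫ z, (D q.2 z - D s₀ z) ^ 2 * R z ∂P))
      (𝓝 (r₀, s₀)) (𝓝 0) := by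
    simpa using ((hDt s₀ hs₀).comp hsnd).sqrt
  have l1 : Tendsto (fun q : ℝ × ℝ => ∫ z, (D q.1 z - D r₀ z) * D s₀ z * k q.1 z ∂P)
      (𝓝 (r₀, s₀)) (𝓝 0) := by
    refine squeeze_zero_norm' ?_ (by
      simpa using (hJ₁.const_mul M).mul_const (√(∫ z, D s₀ z ^ 2 * R z ∂P)))
    filter_upwards [hrI] with q hq
    exact abs_integral_mul_mul_le hM hR ((hD _ hq).sub (hD _ hr₀)) (hD _ hs₀) (hk _ hq)
      (hkt _ hq) (hδ hq hr₀) (hDR _ hs₀)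
  have l2 : Tendsto (fun q : ℝ × ℝ => ∫ z, D r₀ z * (D q.2 z - D s₀ z) * k q.1 z ∂P)
      (𝓝 (r₀, s₀)) (𝓝 0) := by
    refine squeeze_zero_norm' ?_ (by
      simpa using hJ₂.const_mul (M * √(∫ z, D r₀ z ^ 2 * R z ∂P)))
    filter_upwards [hrI, hsI] with q hq hq'
    exact abs_integral_mul_mul_le hM hR (hD _ hr₀) ((hD _ hq').sub (hD _ hs₀)) (hk _ hq)
      (hkt _ hq) (hDR _ hr₀) (hδ hq' hs₀)
  have l3 : Tendsto (fun q : ℝ × ℝ =>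
      ∫ z, (D q.1 z - D r₀ z) * (D q.2 z - D s₀ z) * k q.1 z ∂P) (𝓝 (r₀, s₀)) (𝓝 0) := by
    refine squeeze_zero_norm' ?_ (by simpa using (hJ₁.const_mul M).mul hJ₂)
    filter_upwards [hrI, hsI] with q hq hq'
    exact abs_integral_mul_mul_le hM hR ((hD _ hq).sub (hD _ hr₀)) ((hD _ hq').sub (hD _ hs₀))
      (hk _ hq) (hkt _ hq) (hδ hq hr₀) (hδ hq' hs₀)
  have l4 : Tendsto (fun q : ℝ × ℝ => ∫ z, D r₀ z * D s₀ z * k q.1 z ∂P) (𝓝 (r₀, s₀))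
      (𝓝 (∫ z, D r₀ z * D s₀ z * k r₀ z ∂P)) := by
    refine tendsto_integral_filter_of_dominated_convergence
      (fun z => M * (D r₀ z ^ 2 * R z + D s₀ z ^ 2 * R z)) ?_ ?_
      (((hDR _ hr₀).add (hDR _ hs₀)).const_mul M) ?_
    · filter_upwards [hrI] with q hq using ((hD _ hr₀).mul (hD _ hs₀)).mul (hk _ hq)
    · filter_upwards [hrI] with q hq
      filter_upwards [hkt _ hq] with z hz
      rw [Real.norm_eq_abs, abs_mul, abs_of_nonneg hz.1]
      have h1 : |D r₀ z * D s₀ z| ≤ D r₀ z ^ 2 + D s₀ z ^ 2 := by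
        rw [abs_le]
        constructor <;> nlinarith [sq_nonneg (D r₀ z + D s₀ z), sq_nonneg (D r₀ z - D s₀ z)]
      calc |D r₀ z * D s₀ z| * k q.1 z ≤ (D r₀ z ^ 2 + D s₀ z ^ 2) * (M * R z) := by
            gcongr
            exacts [hz.1, hz.2]
        _ = _ := by ring
    · filter_upwards [hkc] with z hz
      exact ((hz.continuousAt (isOpen_Ioo.mem_nhds hr₀)).tendsto.comp hfst).const_mul _
  have hsum := ((l1.add l2).add l3).add l4
  simp only [zero_add] at hsum
  refine hsum.congr' ?_
  filter_upwards [hrI, hsI] with q hq hq'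
  have i1 := integrable_mul_mul_of_le ((hD _ hq).sub (hD _ hr₀)) (hD _ hs₀) (hk _ hq)
      (hkt _ hq) (hδ hq hr₀) (hDR _ hs₀)
  have i2 := integrable_mul_mul_of_le (hD _ hr₀) ((hD _ hq').sub (hD _ hs₀)) (hk _ hq)
      (hkt _ hq) (hDR _ hr₀) (hδ hq' hs₀)
  have i3 := integrable_mul_mul_of_le ((hD _ hq).sub (hD _ hr₀))
      ((hD _ hq').sub (hD _ hs₀)) (hk _ hq) (hkt _ hq) (hδ hq hr₀) (hδ hq' hs₀)
  have i4 := integrable_mul_mul_of_le (hD _ hr₀) (hD _ hs₀) (hk _ hq) (hkt _ hq)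
      (hDR _ hr₀) (hDR _ hs₀)
  simp only [Pi.sub_apply] at i1 i2 i3
  rw [← integral_add i1 i2, ← integral_add (i1.fun_add i2) i3,
    ← integral_add ((i1.fun_add i2).fun_add i3) i4]
  refine integral_congr_ae (Eventually.of_forall fun z => ?_)
  simp only
  ring

/-- Pointwise this is `(D r - D t)² k r ≥ 0` combined with the growth bound for `k` on the frozen `D
t`. It supplies the hypothesis `hE` of the abstract argument. -/
theorem integral_energy_sub_le {κ : ℝ}
    (hk : ∀ t ∈ Ioo 0 T, AEStronglyMeasurable (k t) P)
    (hkR : ∀ᵐ z ∂P, ∀ t ∈ Ioo 0 T, 0 ≤ k t z ∧ k t z ≤ M * R z)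
    (hkm : ∀ᵐ z ∂P, ∀ t ∈ Ioo 0 T, ∀ r ∈ Ioo 0 T, t ≤ r →
      k r z ≤ (1 + κ * (r - t)) * k t z)
    (hD : ∀ t ∈ Ioo 0 T, AEStronglyMeasurable (D t) P)
    (hDR : ∀ t ∈ Ioo 0 T, Integrable (fun z => D t z ^ 2 * R z) P)
    {t r : ℝ} (ht : t ∈ Ioo 0 T) (hr : r ∈ Ioo 0 T) (htr : t ≤ r) :
    ∫ z, D r z * D r z * k r z ∂P - ∫ z, D t z * D t z * k t z ∂P ≤
      2 * (∫ z, D r z * D r z * k r z ∂P - ∫ z, D r z * D t z * k r z ∂P) +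
        κ * (r - t) * ∫ z, D t z * D t z * k t z ∂P := by
  have hkt : ∀ t ∈ Ioo 0 T, ∀ᵐ z ∂P, 0 ≤ k t z ∧ k t z ≤ M * R z := fun t ht => by
    filter_upwards [hkR] with z hz using hz t ht
  have i1 := integrable_mul_mul_of_le (hD r hr) (hD r hr) (hk r hr) (hkt r hr)
    (hDR r hr) (hDR r hr)
  have i2 := integrable_mul_mul_of_le (hD t ht) (hD t ht) (hk t ht) (hkt t ht)
    (hDR t ht) (hDR t ht)
  have i3 := integrable_mul_mul_of_le (hD r hr) (hD t ht) (hk r hr) (hkt r hr)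
    (hDR r hr) (hDR t ht)
  have i4 : Integrable (fun z => D r z * D r z * k r z - D r z * D t z * k r z) P := i1.sub i3
  rw [← integral_sub i1 i2, ← integral_sub i1 i3, ← integral_const_mul, ← integral_const_mul,
    ← integral_add (i4.const_mul 2) (i2.const_mul _)]
  refine integral_mono_ae (i1.sub i2) ((i4.const_mul 2).fun_add (i2.const_mul _)) ?_
  filter_upwards [hkR, hkm] with z hz hzm
  have h1 : 0 ≤ (D r z - D t z) ^ 2 * k r z := mul_nonneg (sq_nonneg _) (hz r hr).1
  have h2 : D t z ^ 2 * k r z ≤ D t z ^ 2 * ((1 + κ * (r - t)) * k t z) := by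
    gcongr
    exact hzm t ht r hr htr
  linarith

end WeightedForms

/-! ### The energy kernel: bounds, growth in time, measurability -/

noncomputable section Kernel

variable {n : ℕ}

/-- The scalar kernel `α · a α` of the energy form. -/
def energyKernel (ε : ℝ≥0∞) (β : Rn n → ℝ) (a : ℝ → Rn n → Rn n → Matrix (Fin n) (Fin n) ℝ)
    (t : ℝ) (z : Rn n × Rn n) : ℝ :=
  alpha ε β z.1 z.2 ⬝ᵥ (a t z.1 z.2 *ᵥ alpha ε β z.1 z.2)

/-- The weight of the Sobolev seminorm. -/
def sobolevWeight (β : Rn n → ℝ) (z : Rn n × Rn n) : ℝ :=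
  1 / ‖z.2 - z.1‖ ^ ((n : ℝ) + 2 * β z.1)

/-- The increment of `v` between the two points of a pair. -/
def increment (v : Rn n → ℝ) (z : Rn n × Rn n) : ℝ := v z.2 - v z.1

/-- Lebesgue measure on `Ω̃ × Ω̃`. -/
abbrev pairMeasure (Ω : Set (Rn n)) (ε : ℝ≥0∞) : Measure (Rn n × Rn n) :=
  (volume.restrict (tildeDomain Ω ε)).prod (volume.restrict (tildeDomain Ω ε))

theorem sobolevWeight_nonneg (β : Rn n → ℝ) (z : Rn n × Rn n) : 0 ≤ sobolevWeight β z := by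
  unfold sobolevWeight
  positivity

theorem dotProduct_mulVec_eq_sum (A : Matrix (Fin n) (Fin n) ℝ) (ξ : Fin n → ℝ) :
    ξ ⬝ᵥ (A *ᵥ ξ) = ∑ i, ∑ j, A i j * ξ i * ξ j := by
  simp only [dotProduct, Matrix.mulVec, Finset.mul_sum]
  refine Finset.sum_congr rfl fun i _ => Finset.sum_congr rfl fun j _ => by ring

theorem Dstar_dotProduct_mulVec (ε : ℝ≥0∞) (β : Rn n → ℝ)
    (a : ℝ → Rn n → Rn n → Matrix (Fin n) (Fin n) ℝ) (t : ℝ) (v w : Rn n → ℝ) (x y : Rn n) :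
    Dstar ε β v x y ⬝ᵥ (a t x y *ᵥ Dstar ε β w x y) =
      increment v (x, y) * increment w (x, y) * energyKernel ε β a t (x, y) := by
  simp only [Dstar, Matrix.mulVec_smul, smul_dotProduct, dotProduct_smul, smul_eq_mul, increment,
    energyKernel]
  ring

-- `Ω̃` is the Minkowski sum of the open set `Ω` and a closed ball (all of space when `ε = ∞`),
-- hence a union of open translates. Measurability of the domain of integration rests on this.
open scoped Pointwise in
theorem isOpen_tildeDomain {Ω : Set (Rn n)} (hΩ : IsOpen Ω) (ε : ℝ≥0∞) :
    IsOpen (tildeDomain Ω ε) := by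
  have h : tildeDomain Ω ε = Ω + {w : Rn n | edist w 0 ≤ ε} := by
    ext y
    simp only [tildeDomain, interactionDomain, mem_union, mem_ofPred_eq, Set.mem_add]
    constructor
    · rintro (hy | ⟨-, x, hx, hxy⟩)
      · exact ⟨y, hy, 0, by simp, by simp⟩
      · refine ⟨x, hx, y - x, ?_, by abel⟩
        rwa [edist_zero_right, ← edist_eq_enorm_sub]
    · rintro ⟨x, hx, w, hw, rfl⟩
      by_cases hy : x + w ∈ Ω
      · exact Or.inl hy
      · refine Or.inr ⟨hy, x, hx, ?_⟩
        rw [edist_eq_enorm_sub]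
        simpa using hw
  rw [h]
  exact hΩ.add_right

theorem ae_pairMeasure {Ω : Set (Rn n)} (hΩ : IsOpen Ω) {ε : ℝ≥0∞} {p : Rn n × Rn n → Prop}
    (hp : ∀ x ∈ tildeDomain Ω ε, ∀ y ∈ tildeDomain Ω ε, p (x, y)) :
    ∀ᵐ z ∂(pairMeasure Ω ε), p z := by
  have hm := (isOpen_tildeDomain hΩ ε).measurableSet
  rw [pairMeasure, Measure.prod_restrict, ae_restrict_iff' (hm.prod hm)]
  exact Eventually.of_forall fun z hz => hp z.1 hz.1 z.2 hz.2

/-- Off the diagonal and within the horizon this is an equality; otherwise the left side is zero. -/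
theorem sum_sq_alpha_le (ε : ℝ≥0∞) (β : Rn n → ℝ) (x y : Rn n) :
    ∑ i, alpha ε β x y i ^ 2 ≤ sobolevWeight β (x, y) := by
  unfold alpha
  split_ifs with h
  · rcases eq_or_ne y x with rfl | hne
    · simpa using sobolevWeight_nonneg β (y, y)
    · have hpos : 0 < ‖y - x‖ := norm_pos_iff.2 (sub_ne_zero.2 hne)
      have hsum : ∑ i, (y i - x i) ^ 2 = ‖y - x‖ ^ 2 := by
        rw [EuclideanSpace.norm_sq_eq]
        simp
      simp only [div_pow]
      rw [← Finset.sum_div, hsum, sobolevWeight]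
      apply le_of_eq
      have e : (‖y - x‖ ^ ((n : ℝ) / 2 + β x + 1)) ^ 2 =
          ‖y - x‖ ^ ((n : ℝ) + 2 * β x) * ‖y - x‖ ^ 2 := by
        rw [← Real.rpow_natCast, ← Real.rpow_mul hpos.le, ← Real.rpow_natCast ‖y - x‖ 2,
          ← Real.rpow_add hpos]
        congr 1
        push_cast
        ring
      simp only [e]
      have hw : 0 < ‖y - x‖ ^ ((n : ℝ) + 2 * β x) := Real.rpow_pos_of_pos hpos _
      field_simp
  · simpa using sobolevWeight_nonneg β (x, y)

variable {Ω : Set (Rn n)} {ε : ℝ≥0∞} {T alo ahi : ℝ} {β : Rn n → ℝ}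
  {a : ℝ → Rn n → Rn n → Matrix (Fin n) (Fin n) ℝ}

theorem energyKernel_lower (ha : IsTensor Ω ε T alo ahi a) {t : ℝ} (ht : t ∈ Icc 0 T)
    {x y : Rn n} (hx : x ∈ tildeDomain Ω ε) (hy : y ∈ tildeDomain Ω ε) :
    alo * ∑ i, alpha ε β x y i ^ 2 ≤ energyKernel ε β a t (x, y) := by
  rw [energyKernel, dotProduct_mulVec_eq_sum]
  by_cases h : edist y x ≤ ε
  · exact ha.lower t ht x hx y hy h _
  · simp [alpha, h]

theorem energyKernel_nonneg (halo : 0 < alo) (ha : IsTensor Ω ε T alo ahi a) {t : ℝ}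
    (ht : t ∈ Icc 0 T) {x y : Rn n} (hx : x ∈ tildeDomain Ω ε) (hy : y ∈ tildeDomain Ω ε) :
    0 ≤ energyKernel ε β a t (x, y) :=
  (mul_nonneg halo.le (Finset.sum_nonneg fun _ _ => sq_nonneg _)).trans
    (energyKernel_lower ha ht hx hy)

theorem energyKernel_upper (hahi : 0 ≤ ahi) (ha : IsTensor Ω ε T alo ahi a) {t : ℝ}
    (ht : t ∈ Icc 0 T) {x y : Rn n} (hx : x ∈ tildeDomain Ω ε) (hy : y ∈ tildeDomain Ω ε) :
    energyKernel ε β a t (x, y) ≤ ahi * sobolevWeight β (x, y) := by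
  refine le_trans ?_ (mul_le_mul_of_nonneg_left (sum_sq_alpha_le ε β x y) hahi)
  rw [energyKernel, dotProduct_mulVec_eq_sum]
  by_cases h : edist y x ≤ ε
  · exact ha.upper t ht x hx y hy h _
  · simp [alpha, h]

theorem IsTensor.contDiffOn_time (ha : IsTensor Ω ε T alo ahi a) (x y : Rn n) (i j : Fin n) :
    ContDiffOn ℝ 1 (fun t => a t x y i j) (Icc 0 T) :=
  (ha.contDiffOn i j).comp (f := fun t : ℝ => (t, x, y))
    (contDiff_id.prodMk contDiff_const).contDiffOn fun _ ht => ⟨ht, mem_univ _⟩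

theorem continuousOn_energyKernel (ha : IsTensor Ω ε T alo ahi a) (z : Rn n × Rn n) :
    ContinuousOn (fun t => energyKernel ε β a t z) (Icc 0 T) := by
  simp only [energyKernel, dotProduct_mulVec_eq_sum]
  refine continuousOn_finsetSum _ fun i _ => continuousOn_finsetSum _ fun j _ => ?_
  exact ((ha.contDiffOn_time z.1 z.2 i j).continuousOn.mul continuousOn_const).mul
    continuousOn_const

/-- The time derivative of the kernel is at most `ahi |α|²`, and ellipticity at the earlier time
gives `|α|² ≤ k t / alo`. This is where the rate `κ = ahi / alo` originates. -/
theorem energyKernel_growth (halo : 0 < alo) (hahi : 0 ≤ ahi) (ha : IsTensor Ω ε T alo ahi a)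
    {t r : ℝ} (ht : t ∈ Icc 0 T) (hr : r ∈ Icc 0 T) (htr : t ≤ r) {x y : Rn n}
    (hx : x ∈ tildeDomain Ω ε) (hy : y ∈ tildeDomain Ω ε) :
    energyKernel ε β a r (x, y) ≤ (1 + ahi / alo * (r - t)) * energyKernel ε β a t (x, y) := by
  have hsub : energyKernel ε β a r (x, y) - energyKernel ε β a t (x, y) ≤
      ahi * (∑ i, alpha ε β x y i ^ 2) * (r - t) := by
    by_cases h : edist y x ≤ ε
    · have hderiv : ∀ s ∈ interior (Icc 0 T),
          HasDerivAt (fun t => energyKernel ε β a t (x, y))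
            (∑ i, ∑ j, derivWithin (fun s => a s x y i j) (Icc 0 T) s *
              alpha ε β x y i * alpha ε β x y j) s := by
        intro s hs
        simp only [energyKernel, dotProduct_mulVec_eq_sum]
        refine HasDerivAt.fun_sum fun i _ => HasDerivAt.fun_sum fun j _ => ?_
        have h1 := ((ha.contDiffOn_time x y i j).differentiableOn one_ne_zero s
          (interior_subset hs)).hasDerivWithinAt
        exact ((h1.hasDerivAt (mem_interior_iff_mem_nhds.1 hs)).mul_const _).mul_const _
      refine Convex.image_sub_le_mul_sub_of_deriv_le (convex_Icc 0 T)
        (continuousOn_energyKernel ha (x, y))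
        (fun s hs => (hderiv s hs).differentiableAt.differentiableWithinAt) ?_ t ht r hr htr
      intro s hs
      rw [(hderiv s hs).deriv]
      exact ha.deriv_upper s (interior_subset hs) x hx y hy h _
    · simp [energyKernel, alpha, h]
  have hlow := energyKernel_lower (β := β) ha ht hx hy
  have h1 : ahi * (∑ i, alpha ε β x y i ^ 2) ≤ ahi / alo * energyKernel ε β a t (x, y) := by
    calc ahi * (∑ i, alpha ε β x y i ^ 2)
        = ahi / alo * (alo * ∑ i, alpha ε β x y i ^ 2) := by field_simp
      _ ≤ _ := by gcongr
  have h2 := mul_le_mul_of_nonneg_right h1 (sub_nonneg.2 htr)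
  linarith

theorem aemeasurable_rpow_norm (hΩ : IsOpen Ω) (hβ : IsOrder Ω ε β) (c d : ℝ) :
    AEMeasurable (fun z : Rn n × Rn n => ‖z.2 - z.1‖ ^ (c + d * β z.1)) (pairMeasure Ω ε) := by
  have h1 : AEMeasurable (fun z : Rn n × Rn n => β z.1) (pairMeasure Ω ε) :=
    (hβ.1.aemeasurable (isOpen_tildeDomain hΩ ε).measurableSet).comp_quasiMeasurePreserving
      Measure.quasiMeasurePreserving_fst
  have h2 : Measurable fun z : Rn n × Rn n => ‖z.2 - z.1‖ := by fun_prop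
  exact h2.aemeasurable.pow ((h1.const_mul d).const_add c)

theorem aemeasurable_sobolevWeight (hΩ : IsOpen Ω) (hβ : IsOrder Ω ε β) :
    AEMeasurable (sobolevWeight β) (pairMeasure Ω ε) :=
  (aemeasurable_rpow_norm hΩ hβ n 2).const_div 1

theorem aemeasurable_alpha (hΩ : IsOpen Ω) (hβ : IsOrder Ω ε β) (i : Fin n) :
    AEMeasurable (fun z : Rn n × Rn n => alpha ε β z.1 z.2 i) (pairMeasure Ω ε) := by
  have hS : MeasurableSet {z : Rn n × Rn n | edist z.2 z.1 ≤ ε} :=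
    (isClosed_le (continuous_snd.edist continuous_fst) continuous_const).measurableSet
  have h1 : AEMeasurable (fun z : Rn n × Rn n =>
      (z.2 i - z.1 i) / ‖z.2 - z.1‖ ^ ((n : ℝ) / 2 + 1 + 1 * β z.1)) (pairMeasure Ω ε) := by
    have h2 : Measurable fun z : Rn n × Rn n => z.2 i - z.1 i := by fun_prop
    exact h2.aemeasurable.div (aemeasurable_rpow_norm hΩ hβ _ 1)
  refine (h1.indicator hS).congr (Eventually.of_forall fun z => ?_)
  simp only [alpha, indicator, mem_ofPred_eq]
  split_ifs
  · congr 2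
    ring
  · rfl

theorem aestronglyMeasurable_energyKernel (hΩ : IsOpen Ω) (hβ : IsOrder Ω ε β)
    (ha : IsTensor Ω ε T alo ahi a) {t : ℝ} (ht : t ∈ Icc 0 T) :
    AEStronglyMeasurable (energyKernel ε β a t) (pairMeasure Ω ε) := by
  apply AEMeasurable.aestronglyMeasurable
  have : energyKernel ε β a t = fun z => ∑ i, ∑ j,
      a t z.1 z.2 i j * alpha ε β z.1 z.2 i * alpha ε β z.1 z.2 j :=
    funext fun z => dotProduct_mulVec_eq_sum _ _
  rw [this]
  refine Finset.aemeasurable_fun_sum _ fun i _ => Finset.aemeasurable_fun_sum _ fun j _ => ?_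
  have hc : Continuous fun z : Rn n × Rn n => a t z.1 z.2 i j :=
    (ha.contDiffOn i j).continuousOn.comp_continuous (f := fun z : Rn n × Rn n => (t, z.1, z.2))
      (by fun_prop) fun z => ⟨ht, mem_univ _⟩
  exact (hc.measurable.aemeasurable.mul (aemeasurable_alpha hΩ hβ i)).mul
    (aemeasurable_alpha hΩ hβ j)

theorem measurable_increment (v : L2tilde Ω ε) : Measurable (increment v) :=
  ((Lp.stronglyMeasurable v).measurable.comp measurable_snd).sub
    ((Lp.stronglyMeasurable v).measurable.comp measurable_fst)

theorem increment_sub_ae (v w : L2tilde Ω ε) :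
    ∀ᵐ z ∂(pairMeasure Ω ε), increment (v - w : L2tilde Ω ε) z = increment v z - increment w z := by
  have h := Lp.coeFn_sub v w
  filter_upwards [Measure.quasiMeasurePreserving_fst.ae_eq_comp h,
    Measure.quasiMeasurePreserving_snd.ae_eq_comp h] with z h1 h2
  simp only [Function.comp_apply, Pi.sub_apply] at h1 h2
  simp only [increment, h1, h2]
  ring

theorem sobolevSemiSq_eq_lintegral (hΩ : IsOpen Ω) (hβ : IsOrder Ω ε β) (v : L2tilde Ω ε) :
    sobolevSemiSq Ω ε β v =
      ∫⁻ z, ENNReal.ofReal (increment v z ^ 2 * sobolevWeight β z) ∂(pairMeasure Ω ε) := by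
  have hm : AEMeasurable (fun z => ENNReal.ofReal (increment v z ^ 2 * sobolevWeight β z))
      (pairMeasure Ω ε) := (((measurable_increment v).pow_const 2).aemeasurable.mul
    (aemeasurable_sobolevWeight hΩ hβ)).ennreal_ofReal
  rw [lintegral_prod _ hm]
  simp only [sobolevSemiSq, increment, sobolevWeight, mul_one_div]

theorem integrable_increment_sq (hΩ : IsOpen Ω) (hβ : IsOrder Ω ε β) {v : L2tilde Ω ε}
    (hv : sobolevSemiSq Ω ε β v < ⊤) :
    Integrable (fun z => increment v z ^ 2 * sobolevWeight β z) (pairMeasure Ω ε) := by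
  refine ⟨(((measurable_increment v).pow_const 2).aemeasurable.mul
    (aemeasurable_sobolevWeight hΩ hβ)).aestronglyMeasurable, ?_⟩
  rw [hasFiniteIntegral_iff_ofReal (Eventually.of_forall fun z =>
    mul_nonneg (sq_nonneg _) (sobolevWeight_nonneg β z)), ← sobolevSemiSq_eq_lintegral hΩ hβ]
  exact hv

theorem integral_increment_sq (hΩ : IsOpen Ω) (hβ : IsOrder Ω ε β) (v : L2tilde Ω ε) :
    ∫ z, increment v z ^ 2 * sobolevWeight β z ∂(pairMeasure Ω ε) =
      (sobolevSemiSq Ω ε β v).toReal := by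
  rw [integral_eq_lintegral_of_nonneg_ae (Eventually.of_forall fun z =>
    mul_nonneg (sq_nonneg _) (sobolevWeight_nonneg β z))
    (((measurable_increment v).pow_const 2).aemeasurable.mul
    (aemeasurable_sobolevWeight hΩ hβ)).aestronglyMeasurable, ← sobolevSemiSq_eq_lintegral hΩ hβ]

/-- Finite seminorms make the integrand integrable on pairs, which Fubini requires to identify the
iterated Bochner integral with the double one. -/
theorem energyForm_eq_integral (hΩ : IsOpen Ω) (halo : 0 < alo) (hahi : 0 ≤ ahi)
    (hβ : IsOrder Ω ε β) (ha : IsTensor Ω ε T alo ahi a) {t : ℝ} (ht : t ∈ Icc 0 T)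
    {v w : L2tilde Ω ε} (hv : sobolevSemiSq Ω ε β v < ⊤) (hw : sobolevSemiSq Ω ε β w < ⊤) :
    energyForm Ω ε β a t v w =
      ∫ z, increment v z * increment w z * energyKernel ε β a t z ∂(pairMeasure Ω ε) := by
  have hi : Integrable (fun z => increment v z * increment w z * energyKernel ε β a t z)
      (pairMeasure Ω ε) :=
    integrable_mul_mul_of_le (measurable_increment v).aestronglyMeasurable
      (measurable_increment w).aestronglyMeasurable
      (aestronglyMeasurable_energyKernel hΩ hβ ha ht)
      (ae_pairMeasure hΩ fun x hx y hy =>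
        ⟨energyKernel_nonneg halo ha ht hx hy, energyKernel_upper hahi ha ht hx hy⟩)
      (integrable_increment_sq hΩ hβ hv) (integrable_increment_sq hΩ hβ hw)
  rw [integral_prod _ hi]
  simp only [energyForm, Dstar_dotProduct_mulVec]

theorem energySq_lt_top (hΩ : IsOpen Ω) (hahi : 0 ≤ ahi) (ha : IsTensor Ω ε T alo ahi a) {t : ℝ}
    (ht : t ∈ Icc 0 T) {v : L2tilde Ω ε} (hv : sobolevSemiSq Ω ε β v < ⊤) :
    energySq Ω ε β a t v < ⊤ := by
  have hm := (isOpen_tildeDomain hΩ ε).measurableSet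
  have hle : ∫⁻ x in tildeDomain Ω ε, ∫⁻ y in tildeDomain Ω ε,
      ENNReal.ofReal (Dstar ε β v x y ⬝ᵥ (a t x y *ᵥ Dstar ε β v x y)) ≤
      ENNReal.ofReal ahi * sobolevSemiSq Ω ε β v := by
    rw [sobolevSemiSq, ← lintegral_const_mul' _ _ ENNReal.ofReal_ne_top]
    refine setLIntegral_mono' hm fun x hx => ?_
    rw [← lintegral_const_mul' _ _ ENNReal.ofReal_ne_top]
    refine setLIntegral_mono' hm fun y hy => ?_
    rw [← ENNReal.ofReal_mul hahi]
    apply ENNReal.ofReal_le_ofReal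
    rw [Dstar_dotProduct_mulVec]
    have h1 := mul_le_mul_of_nonneg_left (energyKernel_upper (β := β) hahi ha ht hx hy)
      (mul_self_nonneg (increment v (x, y)))
    refine h1.trans (le_of_eq ?_)
    simp only [increment, sobolevWeight]
    ring
  rw [energySq]
  refine ENNReal.mul_lt_top (by simp) (hle.trans_lt (ENNReal.mul_lt_top ENNReal.ofReal_lt_top hv))

end Kernel

/-! ### Solutions as flows, and the resulting estimates -/

noncomputable section Solution

variable {n : ℕ} {bc : Constraint} {Ω : Set (Rn n)} {ε : ℝ≥0∞} {T alo ahi : ℝ} {β : Rn n → ℝ}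
  {a : ℝ → Rn n → Rn n → Matrix (Fin n) (Fin n) ℝ} {u : ℝ → L2tilde Ω ε}

theorem norm_resDom_le (v : L2tilde Ω ε) : ‖resDom Ω ε v‖ ≤ ‖v‖ :=
  norm_Lp_toLp_restrict_le Ω v

theorem sobolevSemiSq_le_sq (v : L2tilde Ω ε) :
    sobolevSemiSq Ω ε β v ≤ sobolevENorm Ω ε β v ^ 2 := by
  calc sobolevSemiSq Ω ε β v = (sobolevSemiSq Ω ε β v ^ (1 / 2 : ℝ)) ^ 2 := by
        rw [← ENNReal.rpow_natCast, ← ENNReal.rpow_mul]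
        norm_num
    _ ≤ _ := by
        gcongr
        exact le_add_self

theorem MemHc.sobolevSemiSq_lt_top {v : L2tilde Ω ε} (hv : MemHc bc Ω ε β v) :
    sobolevSemiSq Ω ε β v < ⊤ :=
  (sobolevSemiSq_le_sq v).trans_lt (ENNReal.pow_lt_top hv.1)

theorem MemHc.norm_le_sobolevNorm {v : L2tilde Ω ε} (hv : MemHc bc Ω ε β v) :
    ‖v‖ ≤ sobolevNorm Ω ε β v := by
  rw [← toReal_enorm v]
  exact ENNReal.toReal_mono hv.1.ne le_self_add

theorem MemHc.memVc (hΩ : IsOpen Ω) (hahi : 0 ≤ ahi) (ha : IsTensor Ω ε T alo ahi a)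
    {v : L2tilde Ω ε} (hv : MemHc bc Ω ε β v) : MemVc bc Ω ε β a T v :=
  ⟨fun _ ht => energySq_lt_top hΩ hahi ha ht hv.sobolevSemiSq_lt_top, hv.2⟩

theorem ContinuousInHc.continuousOn (hu : ContinuousInHc bc Ω ε β T u) :
    ContinuousOn u (Ioc 0 T) := by
  intro t ht
  rw [ContinuousWithinAt, tendsto_iff_edist_tendsto_0]
  refine tendsto_of_tendsto_of_tendsto_of_le_of_le tendsto_const_nhds (hu t ht).2
    (fun _ => zero_le) fun s => ?_
  rw [edist_eq_enorm_sub]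
  exact le_self_add

theorem ContinuousInHc.continuousOn_norm_sq (hu : ContinuousInHc bc Ω ε β T u) :
    ContinuousOn (fun t => ‖resDom Ω ε (u t)‖ ^ 2) (Ioc 0 T) :=
  ((resDom Ω ε).continuous.comp_continuousOn hu.continuousOn).norm.pow 2

theorem ContinuousInHc.tendsto_integral_increment (hΩ : IsOpen Ω) (hβ : IsOrder Ω ε β)
    (hu : ContinuousInHc bc Ω ε β T u) {t : ℝ} (ht : t ∈ Ioo 0 T) :
    Tendsto (fun s => ∫ z, (increment (u s) z - increment (u t) z) ^ 2 * sobolevWeight β z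
      ∂(pairMeasure Ω ε)) (𝓝 t) (𝓝 0) := by
  have h1 := (hu t (Ioo_subset_Ioc_self ht)).2
  rw [nhdsWithin_eq_nhds.2 (Ioc_mem_nhds ht.1 ht.2)] at h1
  have h2 : Tendsto (fun s => sobolevSemiSq Ω ε β (u s - u t)) (𝓝 t) (𝓝 0) := by
    have h3 := ((ENNReal.continuous_pow 2).tendsto 0).comp h1
    rw [zero_pow two_ne_zero] at h3
    exact tendsto_of_tendsto_of_tendsto_of_le_of_le tendsto_const_nhds h3
      (fun _ => zero_le) fun s => sobolevSemiSq_le_sq _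
  have h4 := (ENNReal.tendsto_toReal ENNReal.zero_ne_top).comp h2
  rw [ENNReal.toReal_zero] at h4
  refine h4.congr fun s => ?_
  rw [Function.comp_apply, ← integral_increment_sq hΩ hβ]
  refine integral_congr_ae ?_
  filter_upwards [increment_sub_ae (u s) (u t)] with z hz
  rw [hz]

/-- `B_r(u(r), u(s))` as an integral over pairs of points. -/
def solutionForm (Ω : Set (Rn n)) (ε : ℝ≥0∞) (β : Rn n → ℝ)
    (a : ℝ → Rn n → Rn n → Matrix (Fin n) (Fin n) ℝ) (u : ℝ → L2tilde Ω ε) (r s : ℝ) : ℝ :=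
  ∫ z, increment (u r) z * increment (u s) z * energyKernel ε β a r z ∂(pairMeasure Ω ε)

theorem continuousOn_solutionForm (hΩ : IsOpen Ω) (halo : 0 < alo) (hahi : 0 ≤ ahi)
    (hβ : IsOrder Ω ε β) (ha : IsTensor Ω ε T alo ahi a) (hu : ContinuousInHc bc Ω ε β T u) :
    ContinuousOn (Function.uncurry (solutionForm Ω ε β a u)) (Ioo 0 T ×ˢ Ioo 0 T) :=
  continuousOn_integral_mul_mul (D := fun t => increment (u t)) hahi (sobolevWeight_nonneg β)
    (aemeasurable_sobolevWeight hΩ hβ).aestronglyMeasurable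
    (fun _ ht => aestronglyMeasurable_energyKernel hΩ hβ ha (Ioo_subset_Icc_self ht))
    (ae_pairMeasure hΩ fun _ hx _ hy _ ht =>
      ⟨energyKernel_nonneg halo ha (Ioo_subset_Icc_self ht) hx hy,
        energyKernel_upper hahi ha (Ioo_subset_Icc_self ht) hx hy⟩)
    (Eventually.of_forall fun z => (continuousOn_energyKernel ha z).mono Ioo_subset_Icc_self)
    (fun t _ => (measurable_increment (u t)).aestronglyMeasurable)
    (fun t ht => integrable_increment_sq hΩ hβ
      (hu t (Ioo_subset_Ioc_self ht)).1.sobolevSemiSq_lt_top)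
    (fun _ ht => hu.tendsto_integral_increment hΩ hβ ht)

theorem solutionForm_sub_le (hΩ : IsOpen Ω) (halo : 0 < alo) (hahi : 0 ≤ ahi)
    (hβ : IsOrder Ω ε β) (ha : IsTensor Ω ε T alo ahi a) (hu : ContinuousInHc bc Ω ε β T u)
    {t r : ℝ} (ht : t ∈ Ioo 0 T) (hr : r ∈ Ioo 0 T) (htr : t ≤ r) :
    solutionForm Ω ε β a u r r - solutionForm Ω ε β a u t t ≤
      2 * (solutionForm Ω ε β a u r r - solutionForm Ω ε β a u r t) +
        ahi / alo * (r - t) * solutionForm Ω ε β a u t t :=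
  integral_energy_sub_le (D := fun t => increment (u t)) (M := ahi) (R := sobolevWeight β)
    (fun _ ht => aestronglyMeasurable_energyKernel hΩ hβ ha (Ioo_subset_Icc_self ht))
    (ae_pairMeasure hΩ fun _ hx _ hy _ ht =>
      ⟨energyKernel_nonneg halo ha (Ioo_subset_Icc_self ht) hx hy,
        energyKernel_upper hahi ha (Ioo_subset_Icc_self ht) hx hy⟩)
    (ae_pairMeasure hΩ fun _ hx _ hy _ ht _ hr htr =>
      energyKernel_growth halo hahi ha (Ioo_subset_Icc_self ht) (Ioo_subset_Icc_self hr) htr hx hy)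
    (fun t _ => (measurable_increment (u t)).aestronglyMeasurable)
    (fun t ht => integrable_increment_sq hΩ hβ
      (hu t (Ioo_subset_Ioc_self ht)).1.sobolevSemiSq_lt_top) ht hr htr

theorem solutionForm_self_nonneg (hΩ : IsOpen Ω) (halo : 0 < alo)
    (ha : IsTensor Ω ε T alo ahi a) {t : ℝ} (ht : t ∈ Ioo 0 T) :
    0 ≤ solutionForm Ω ε β a u t t := by
  refine integral_nonneg_of_ae (ae_pairMeasure hΩ fun x hx y hy => ?_)
  exact mul_nonneg (mul_self_nonneg _) (energyKernel_nonneg halo ha (Ioo_subset_Icc_self ht) hx hy)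

theorem integral_mul_inner_eq {X : Type*} [NormedAddCommGroup X] [InnerProductSpace ℝ X]
    [CompleteSpace X] {ψ : ℝ → ℝ} {w : ℝ → X} {s : Set ℝ} (hψ : Continuous ψ)
    (hψc : HasCompactSupport ψ) (hw : IntegrableOn w s) (c : X) :
    ∫ t in s, ψ t * inner ℝ (w t) c = inner ℝ (∫ t in s, ψ t • w t) c := by
  obtain ⟨C, hC⟩ := hψ.bounded_above_of_compact_support hψc
  have hi : IntegrableOn (fun t => ψ t • w t) s :=
    hw.bdd_smul C hψ.aestronglyMeasurable (Eventually.of_forall hC)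
  rw [real_inner_comm, ← integral_inner hi]
  refine integral_congr_ae (Eventually.of_forall fun t => ?_)
  simp only [inner_smul_right, real_inner_comm]

/-- The equation is tested with the frozen state `u s`, admissible because `H_c` lies in `V_c`. This
gives a weak derivative in time, and continuity of both sides makes it classical. -/
theorem hasDerivAt_inner_solution (hΩ : IsOpen Ω) (halo : 0 < alo) (hahi : 0 ≤ ahi)
    (hβ : IsOrder Ω ε β) (ha : IsTensor Ω ε T alo ahi a) (hsol : IsSolution bc Ω ε β a T u)
    (hu : ContinuousInHc bc Ω ε β T u) {s r : ℝ} (hs : s ∈ Ioo 0 T) (hr : r ∈ Ioo 0 T) :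
    HasDerivAt (fun r => inner ℝ (resDom Ω ε (u r)) (resDom Ω ε (u s)))
      (-(solutionForm Ω ε β a u r s)) r := by
  obtain ⟨u', hu', hweak, heq⟩ := hsol.equation
  have hmem := fun t (ht : t ∈ Ioo 0 T) => (hu t (Ioo_subset_Ioc_self ht)).1
  have hUc : ContinuousOn (fun t => resDom Ω ε (u t)) (Ioo 0 T) :=
    (resDom Ω ε).continuous.comp_continuousOn (hu.continuousOn.mono Ioo_subset_Ioc_self)
  have hUi : IntegrableOn (fun t => resDom Ω ε (u t)) (Ioo 0 T) :=
    (resDom Ω ε).integrable_comp (hsol.memLp.integrable one_le_two)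
  have hbc : ContinuousOn (fun r => -(solutionForm Ω ε β a u r s)) (Ioo 0 T) :=
    ((continuousOn_solutionForm hΩ halo hahi hβ ha hu).comp (f := fun r => (r, s))
      (by fun_prop) fun r hr => ⟨hr, hs⟩).neg
  refine hasDerivAt_of_integral_deriv_mul_eq (p := 0) (q := T) (hUc.inner continuousOn_const)
    hbc ?_ hr
  intro ψ hψ hψc hψs
  have hψ1 : ContDiff ℝ 1 ψ := hψ.of_le (by exact_mod_cast le_top)
  rw [integral_mul_inner_eq (hψ1.continuous_deriv le_rfl) hψc.deriv hUi, hweak ψ hψ hψc hψs,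
    inner_neg_left, ← integral_mul_inner_eq hψ.continuous hψc (hu'.integrable one_le_two)]
  congr 1
  refine integral_congr_ae ?_
  -- The exceptional null set depends on the test function, harmlessly since `s` is fixed.
  filter_upwards [heq (u s) ((hmem s hs).memVc hΩ hahi ha),
    ae_restrict_mem measurableSet_Ioo] with t ht htI
  rw [energyForm_eq_integral hΩ halo hahi hβ ha (Ioo_subset_Icc_self htI)
    (hmem t htI).sobolevSemiSq_lt_top (hmem s hs).sobolevSemiSq_lt_top] at ht
  rw [solutionForm]
  congr 1
  linarith

/-- Logarithmic convexity of the energy of a solution, in the time variable `exp (a^* t / a_*)`. -/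
theorem norm_sq_solution_le (hΩ : IsOpen Ω) (halo : 0 < alo) (hahi : 0 < ahi)
    (hβ : IsOrder Ω ε β) (ha : IsTensor Ω ε T alo ahi a) (hsol : IsSolution bc Ω ε β a T u)
    (hu : ContinuousInHc bc Ω ε β T u) {t₁ t θ : ℝ} (ht₁ : 0 ≤ t₁) (ht₁T : t₁ < T)
    (hc : ContinuousOn (fun t => ‖resDom Ω ε (u t)‖ ^ 2) (Icc t₁ T)) (ht : t ∈ Icc t₁ T)
    (hθ : θ = (Real.exp (ahi / alo * t) - Real.exp (ahi / alo * t₁)) /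
      (Real.exp (ahi / alo * T) - Real.exp (ahi / alo * t₁))) :
    ‖resDom Ω ε (u t)‖ ^ 2 ≤
      (‖resDom Ω ε (u t₁)‖ ^ 2) ^ (1 - θ) * (‖resDom Ω ε (u T)‖ ^ 2) ^ θ :=
  norm_sq_le_rpow_mul_rpow (U := fun t => resDom Ω ε (u t)) (div_pos hahi halo)
    (continuousOn_solutionForm hΩ halo hahi.le hβ ha hu)
    (fun _ hs _ hr => hasDerivAt_inner_solution hΩ halo hahi.le hβ ha hsol hu hs hr)
    (fun _ ht _ hr htr => solutionForm_sub_le hΩ halo hahi.le hβ ha hu ht hr htr)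
    ht₁ ht₁T hc ht hθ

/-- As the energy form is nonnegative, `‖u‖²` on `Ω` decreases, so its value at `t` is at most its
average over `(0,t)`. -/
theorem mul_norm_sq_solution_le (hΩ : IsOpen Ω) (halo : 0 < alo) (hahi : 0 ≤ ahi)
    (hβ : IsOrder Ω ε β) (ha : IsTensor Ω ε T alo ahi a) (hsol : IsSolution bc Ω ε β a T u)
    (hu : ContinuousInHc bc Ω ε β T u) {t : ℝ} (ht : t ∈ Ioo 0 T) :
    t * ‖resDom Ω ε (u t)‖ ^ 2 ≤ timeL2Norm T u ^ 2 := by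
  have hanti := antitoneOn_norm_sq (U := fun t => resDom Ω ε (u t))
    (continuousOn_solutionForm hΩ halo hahi hβ ha hu)
    (fun _ hs _ hr => hasDerivAt_inner_solution hΩ halo hahi hβ ha hsol hu hs hr)
    (fun _ ht => solutionForm_self_nonneg hΩ halo ha ht)
  have hi : IntegrableOn (fun s => ‖u s‖ ^ 2) (Ioo 0 T) :=
    hsol.memLp.integrable_norm_pow two_ne_zero
  have hsub : Ioo 0 t ⊆ Ioo 0 T := Ioo_subset_Ioo_right ht.2.le
  rw [timeL2Norm, Real.sq_sqrt (integral_nonneg fun _ => sq_nonneg _)]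
  calc t * ‖resDom Ω ε (u t)‖ ^ 2 = ∫ _ in Ioo 0 t, ‖resDom Ω ε (u t)‖ ^ 2 := by
        simp [ht.1.le]
    _ ≤ ∫ s in Ioo 0 t, ‖u s‖ ^ 2 := by
        refine setIntegral_mono_on (by simp) (hi.mono_set hsub) measurableSet_Ioo fun s hs => ?_
        refine (hanti (hsub hs) ht hs.2.le).trans ?_
        have := norm_resDom_le (u s)
        simp only
        gcongr
    _ ≤ _ := setIntegral_mono_set hi (Eventually.of_forall fun _ => sq_nonneg _)
        hsub.eventuallyLE

theorem HasInitialValue.continuousOn_norm_sq (hu : ContinuousInHc bc Ω ε β T u)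
    (h0 : HasInitialValue bc Ω ε u) :
    ContinuousOn (fun t => ‖resDom Ω ε (u t)‖ ^ 2) (Icc 0 T) := by
  intro t ht
  rcases eq_or_lt_of_le ht.1 with rfl | h
  · have h1 : ContinuousWithinAt (fun t => resDom Ω ε (u t)) (Ioi 0) 0 := h0.2
    exact ((continuousWithinAt_Ioi_iff_Ici.1 h1).mono Icc_subset_Ici_self).norm.pow 2
  · refine (hu.continuousOn_norm_sq t ⟨h, ht.2⟩).mono_of_mem_nhdsWithin ?_
    filter_upwards [self_mem_nhdsWithin, nhdsWithin_le_nhds (Ioi_mem_nhds h)] with s hs hs'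
    exact ⟨hs', hs.2⟩

theorem interpolation_weight_mem_Ioo {κ t₁ t T : ℝ} (hκ : 0 < κ) (h1 : t₁ < t) (h2 : t < T) :
    (Real.exp (κ * t) - Real.exp (κ * t₁)) / (Real.exp (κ * T) - Real.exp (κ * t₁)) ∈
      Ioo (0 : ℝ) 1 := by
  have e1 : Real.exp (κ * t₁) < Real.exp (κ * t) := Real.exp_lt_exp.2 (by gcongr)
  have e2 : Real.exp (κ * t) < Real.exp (κ * T) := Real.exp_lt_exp.2 (by gcongr)
  exact ⟨div_pos (by linarith) (by linarith), (div_lt_one (by linarith)).2 (by linarith)⟩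

theorem sq_rpow_eq {x : ℝ} (hx : 0 ≤ x) (p : ℝ) : (x ^ 2) ^ p = (x ^ p) ^ 2 := by
  rw [← Real.rpow_natCast x 2, ← Real.rpow_natCast (x ^ p) 2, ← Real.rpow_mul hx,
    ← Real.rpow_mul hx, mul_comm]

theorem norm_solution_le_interpolation (hΩ : IsOpen Ω) (halo : 0 < alo) (hahi : 0 < ahi)
    (hβ : IsOrder Ω ε β) (ha : IsTensor Ω ε T alo ahi a) (hsol : IsSolution bc Ω ε β a T u)
    (hu : ContinuousInHc bc Ω ε β T u) {t₁ t θ : ℝ} (ht₁ : 0 < t₁) (ht₁t : t₁ < t) (htT : t < T)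
    (hθ : θ = (Real.exp (ahi / alo * t) - Real.exp (ahi / alo * t₁)) /
      (Real.exp (ahi / alo * T) - Real.exp (ahi / alo * t₁))) :
    ‖resDom Ω ε (u t)‖ ≤
      1 / √t₁ ^ (1 - θ) * timeL2Norm T u ^ (1 - θ) * sobolevNorm Ω ε β (u T) ^ θ := by
  have hθI := interpolation_weight_mem_Ioo (div_pos hahi halo) ht₁t htT
  rw [← hθ] at hθI
  have hTI : T ∈ Ioc 0 T := ⟨by linarith, le_rfl⟩
  have hmain := norm_sq_solution_le hΩ halo hahi hβ ha hsol hu ht₁.le (ht₁t.trans htT)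
    (hu.continuousOn_norm_sq.mono fun x hx => ⟨ht₁.trans_le hx.1, hx.2⟩) ⟨ht₁t.le, htT.le⟩ hθ
  have hN : 0 ≤ timeL2Norm T u := Real.sqrt_nonneg _
  have hS : 0 ≤ sobolevNorm Ω ε β (u T) := ENNReal.toReal_nonneg
  have hsq : 0 < √t₁ := Real.sqrt_pos.2 ht₁
  have h1 : ‖resDom Ω ε (u t₁)‖ ^ 2 ≤ (timeL2Norm T u / √t₁) ^ 2 := by
    rw [div_pow, Real.sq_sqrt ht₁.le, le_div_iff₀ ht₁, mul_comm]
    exact mul_norm_sq_solution_le hΩ halo hahi.le hβ ha hsol hu ⟨ht₁, ht₁t.trans htT⟩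
  have h2 : ‖resDom Ω ε (u T)‖ ^ 2 ≤ sobolevNorm Ω ε β (u T) ^ 2 := by
    have := (norm_resDom_le (u T)).trans (hu T hTI).1.norm_le_sobolevNorm
    gcongr
  refine le_of_sq_le_sq ?_ (by positivity)
  calc ‖resDom Ω ε (u t)‖ ^ 2
      ≤ ((timeL2Norm T u / √t₁) ^ 2) ^ (1 - θ) * (sobolevNorm Ω ε β (u T) ^ 2) ^ θ :=
        hmain.trans (mul_le_mul (Real.rpow_le_rpow (by positivity) h1 (by linarith [hθI.2]))
          (Real.rpow_le_rpow (by positivity) h2 hθI.1.le) (by positivity) (by positivity))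
    _ = _ := by
        rw [sq_rpow_eq (by positivity), sq_rpow_eq hS, Real.div_rpow hN hsq.le]
        ring

/-- From `exp x ≥ 1 + x`. A linear lower bound turns the interpolation estimate into exponential
decay in `t`, integrable explicitly. -/
theorem mul_le_interpolation_weight {κ t T : ℝ} (hκ : 0 < κ) (hT : 0 < T) :
    κ / (Real.exp (κ * T) - 1) * t ≤
      (Real.exp (κ * t) - Real.exp (κ * 0)) / (Real.exp (κ * T) - Real.exp (κ * 0)) := by
  have hden : 0 < Real.exp (κ * T) - 1 := by
    have := Real.add_one_lt_exp (x := κ * T) (by positivity)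
    have : 0 < κ * T := by positivity
    linarith
  rw [mul_zero, Real.exp_zero, div_mul_eq_mul_div]
  gcongr
  linarith [Real.add_one_le_exp (κ * t)]

theorem norm_sq_solution_le_exp (hΩ : IsOpen Ω) (halo : 0 < alo) (hahi : 0 < ahi) (hT : 0 < T)
    (hβ : IsOrder Ω ε β) (ha : IsTensor Ω ε T alo ahi a) (hsol : IsSolution bc Ω ε β a T u)
    (hu : ContinuousInHc bc Ω ε β T u) (h0 : HasInitialValue bc Ω ε u)
    (hS0 : 0 < sobolevNorm Ω ε β (u T)) (hS1 : sobolevNorm Ω ε β (u T) < 1)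
    {t : ℝ} (ht : t ∈ Ioo 0 T) :
    ‖resDom Ω ε (u t)‖ ^ 2 ≤ (1 + ‖u 0‖) ^ 2 *
      Real.exp (-(2 * (ahi / alo / (Real.exp (ahi / alo * T) - 1)) *
        Real.log (1 / sobolevNorm Ω ε β (u T))) * t) := by
  set S := sobolevNorm Ω ε β (u T) with hS
  have hκ : 0 < ahi / alo := div_pos hahi halo
  have hθI := interpolation_weight_mem_Ioo hκ ht.1 ht.2
  have hθc := mul_le_interpolation_weight (t := t) hκ hT
  set θ := (Real.exp (ahi / alo * t) - Real.exp (ahi / alo * 0)) /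
      (Real.exp (ahi / alo * T) - Real.exp (ahi / alo * 0)) with hθ
  set c := ahi / alo / (Real.exp (ahi / alo * T) - 1)
  have hTI : T ∈ Ioc 0 T := ⟨hT, le_rfl⟩
  have hmain := norm_sq_solution_le hΩ halo hahi hβ ha hsol hu le_rfl hT
    (h0.continuousOn_norm_sq hu) (Ioo_subset_Icc_self ht) hθ
  have h1 : ‖resDom Ω ε (u 0)‖ ^ 2 ≤ (1 + ‖u 0‖) ^ 2 := by
    have := norm_resDom_le (u 0)
    gcongr
    linarith
  have h2 : ‖resDom Ω ε (u T)‖ ^ 2 ≤ S ^ 2 := by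
    have := (norm_resDom_le (u T)).trans (hu T hTI).1.norm_le_sobolevNorm
    gcongr
  -- Adding `1` makes the base at least one, so the exponent `1 - θ` can be raised to `1` uniformly
  -- in `t`.
  have h3 : ((1 + ‖u 0‖) ^ 2) ^ (1 - θ) ≤ (1 + ‖u 0‖) ^ 2 := by
    have hone : (1 : ℝ) ≤ (1 + ‖u 0‖) ^ 2 := one_le_pow₀ (by linarith [norm_nonneg (u 0)])
    calc ((1 + ‖u 0‖) ^ 2) ^ (1 - θ) ≤ ((1 + ‖u 0‖) ^ 2) ^ (1 : ℝ) :=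
          Real.rpow_le_rpow_of_exponent_le hone (by linarith [hθI.1])
      _ = _ := Real.rpow_one _
  have h4 : (S ^ 2) ^ θ ≤ Real.exp (-(2 * c * Real.log (1 / S)) * t) := by
    rw [Real.rpow_def_of_pos (by positivity), Real.log_pow, one_div, Real.log_inv]
    apply Real.exp_le_exp.2
    have hlog : Real.log S < 0 := Real.log_neg hS0 hS1
    push_cast
    nlinarith
  calc ‖resDom Ω ε (u t)‖ ^ 2
      ≤ ((1 + ‖u 0‖) ^ 2) ^ (1 - θ) * (S ^ 2) ^ θ :=
        hmain.trans (mul_le_mul (Real.rpow_le_rpow (by positivity) h1 (by linarith [hθI.2]))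
          (Real.rpow_le_rpow (by positivity) h2 hθI.1.le) (by positivity) (by positivity))
    _ ≤ _ := mul_le_mul h3 h4 (by positivity) (by positivity)

/-- Integrating over the whole half-line gives `K² / l`, free of `T`; the square root produces the
exponent `-1/2`. -/
theorem timeL2Norm_le_of_norm_sq_le_exp {X : Type*} [NormedAddCommGroup X] {w : ℝ → X}
    {K l : ℝ} (hK : 0 ≤ K) (hl : 0 < l)
    (hw : ∀ t ∈ Ioo 0 T, ‖w t‖ ^ 2 ≤ K ^ 2 * Real.exp (-l * t)) :
    timeL2Norm T w ≤ K * l ^ (-(1 / 2) : ℝ) := by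
  have hi : IntegrableOn (fun t => K ^ 2 * Real.exp (-l * t)) (Ioi 0) :=
    (integrableOn_exp_mul_Ioi (neg_neg_of_pos hl) 0).const_mul _
  have hsub : Ioo 0 T ⊆ Ioi 0 := Ioo_subset_Ioi_self
  have hint : ∫ t in Ioo 0 T, ‖w t‖ ^ 2 ≤ K ^ 2 / l := by
    calc ∫ t in Ioo 0 T, ‖w t‖ ^ 2 ≤ ∫ t in Ioo 0 T, K ^ 2 * Real.exp (-l * t) := by
          refine integral_mono_of_nonneg (Eventually.of_forall fun _ => sq_nonneg _)
            (hi.mono_set hsub) ?_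
          filter_upwards [ae_restrict_mem measurableSet_Ioo] with t ht using hw t ht
      _ ≤ ∫ t in Ioi 0, K ^ 2 * Real.exp (-l * t) :=
          setIntegral_mono_set hi
            (Eventually.of_forall fun _ => by simp only [Pi.zero_apply]; positivity)
            hsub.eventuallyLE
      _ = K ^ 2 / l := by
          rw [integral_const_mul, integral_exp_mul_Ioi (neg_neg_of_pos hl)]
          simp [div_eq_mul_inv]
  rw [timeL2Norm]
  refine Real.sqrt_le_iff.2 ⟨by positivity, hint.trans (le_of_eq ?_)⟩
  rw [mul_pow, ← Real.rpow_natCast (l ^ _), ← Real.rpow_mul hl.le]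
  norm_num [Real.rpow_neg_one, div_eq_mul_inv]

end Solution

end NonlocalDiffusion

theorem theorem4p1 {n : ℕ} (bc : Constraint) (Ω : Set (Rn n)) (hΩ : IsOpen Ω)
    (hΩb : Bornology.IsBounded Ω) (ε : ℝ≥0∞) (hε : 0 < ε) (T : ℝ) (hT : 0 < T)
    (alo ahi : ℝ) (halo : 0 < alo) (hahi : alo ≤ ahi) :
    (∀ t₀ ∈ Ioo 0 T, ∃ θ ∈ Ioo (0 : ℝ) 1, ∃ C > 0,
      ∀ (β : Rn n → ℝ) (a : ℝ → Rn n → Rn n → Matrix (Fin n) (Fin n) ℝ) (u : ℝ → L2tilde Ω ε),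
        IsOrder Ω ε β → IsTensor Ω ε T alo ahi a →
        IsSolution bc Ω ε β a T u → ContinuousInHc bc Ω ε β T u →
        ‖resDom Ω ε (u t₀)‖ ≤
          C * timeL2Norm T u ^ (1 - θ) * sobolevNorm Ω ε β (u T) ^ θ) ∧
    (∃ C > 0,
      ∀ (β : Rn n → ℝ) (a : ℝ → Rn n → Rn n → Matrix (Fin n) (Fin n) ℝ) (u : ℝ → L2tilde Ω ε),
        IsOrder Ω ε β → IsTensor Ω ε T alo ahi a →
        IsSolution bc Ω ε β a T u → ContinuousInHc bc Ω ε β T u →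
        HasInitialValue bc Ω ε u →
        0 < sobolevNorm Ω ε β (u T) → sobolevNorm Ω ε β (u T) < 1 →
        timeL2Norm T (fun t => resDom Ω ε (u t)) ≤
          C * (1 + ‖u 0‖) * Real.log (1 / sobolevNorm Ω ε β (u T)) ^ (-(1 / 2) : ℝ)) := by
  have hahi0 : 0 < ahi := halo.trans_le hahi
  have hκ : 0 < ahi / alo := div_pos hahi0 halo
  refine ⟨fun t₀ ht₀ => ?_, ?_⟩
  · have h1 : 0 < t₀ / 2 := half_pos ht₀.1
    have h2 : t₀ / 2 < t₀ := half_lt_self ht₀.1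
    refine ⟨_, interpolation_weight_mem_Ioo hκ h2 ht₀.2, _, ?_,
      fun β a u hβ ha hsol hu =>
        norm_solution_le_interpolation hΩ halo hahi0 hβ ha hsol hu h1 h2 ht₀.2 rfl⟩
    have := Real.sqrt_pos.2 h1
    positivity
  · set c := ahi / alo / (Real.exp (ahi / alo * T) - 1) with hc
    have hc0 : 0 < c := by
      have h1 : 1 < Real.exp (ahi / alo * T) := Real.one_lt_exp_iff.2 (by positivity)
      exact div_pos hκ (by linarith)
    -- The decay rate is `l = 2 c log (1/S)`; the constant is the first factor of `l ^ (-1/2)`.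
    refine ⟨(2 * c) ^ (-(1 / 2) : ℝ), by positivity, fun β a u hβ ha hsol hu h0 hS0 hS1 => ?_⟩
    have hlog : 0 < Real.log (1 / sobolevNorm Ω ε β (u T)) :=
      Real.log_pos ((one_lt_div hS0).2 hS1)
    refine (timeL2Norm_le_of_norm_sq_le_exp (by positivity) (mul_pos (by positivity) hlog)
      fun t ht => norm_sq_solution_le_exp hΩ halo hahi0 hT hβ ha hsol hu h0 hS0 hS1 ht).trans
        (le_of_eq ?_)
    rw [← hc, Real.mul_rpow (by positivity) hlog.le]
    ring
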